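/- **Setting.** Let $d,T,D\ge 1$ and $\mathcal X_T=\{X=(x(1),\dots,x(T)) : x(t)\in[0,1]^d\}$. *Networks.* An $L$-layer feed-forward network is a composition of $L$ affine maps with a coordinatewise activation between consecutive ones; its width is the largest size of a hidden layer and its parameter count is the number of its nonzero weights and biases. *Transformers.* $\mathcal H(h,n,d,T,M)$ is the class of functions $$H(X)=\hat F\Bigl(\hat c_0+W_O\operatorname{Concat}_{i=1}^h\Bigl(\sum_{t=1}^T\sigma_i(t)\,W_{V,i}\,\hat x(t)\Bigr)\Bigr),\qquad \sigma_i(t)=\frac{\exp(\beta\,(W_{Q,i}\hat c_0)^\top W_{K,i}\hat x(t))}{\sum_{t'=1}^T\exp(\beta\,(W_{Q,i}\hat c_0)^\top W_{K,i}\hat x(t'))},$$ where $\hat x(t)=P_\phi(x(t),t)\in\mathbb R^{nh}$, $\beta>0$, $\hat c_0\in\mathbb R^{nh}$, and: the encoder $P_\phi$ is a two-layer network reading $x$ and the one-hot code of the position $t$, with $\|P_\phi(x,t)\|_2\le 1$ on $[0,1]^d\times[T]$; $W_{Q,i},W_{K,i},W_{V,i}\in\mathbb R^{n\times nh}$ and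 $W_O\in\mathbb R^{nh\times nh}$ have entries bounded by $1$ in magnitude; $\hat F:\mathbb R^{nh}\to\mathbb R$ is a two-layer network whose weights and biases are bounded by $1$ in magnitude; each of the two networks has some $1$-Lipschitz activation; and $P_\phi$ and $\hat F$ have together at most $M$ parameters. The class $\mathcal H$ $\epsilon$-approximates a set $\mathcal F$ of functions if for every $F\in\mathcal F$ there is $H\in\mathcal H$ with $\sup_{X\in\mathcal X_T}|H(X)-F(X)|<\epsilon$. *Targets.* $\mathcal F_D^{d,T}$ is the set of functions $X\mapsto F_0(\bar z_1(X),\dots,\bar z_D(X))$, $\bar z_i(X)=\min_{t\in S_i}f_i(x(t))$, where $S_i\subseteq[T]$ with $|S_i|\ge T/4$, $F_0:[0,1]^D\to\mathbb R$ is $C^1$, each $f_i:[0,1]^d\to[0,1]$ is $C^2$ with a unique global minimizer $x^{(i)}$ and a positive definite Hessian there, the points $x^{(i)}$ are pairwise distinct, and all partial derivatives of $F_0$ at $(f_1(x^{(1)}),\dots,f_D(x^{(D)}))$ are nonzero (derivatives at boundary points are taken within the cube). *Approximation assumption.* For constants $C_1,\gamma_1,C_2,\gamma_2>0$ and $\Lambda\ge0$,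 let $\mathcal F_D^{d,T}(C_1,\gamma_1,C_2,\gamma_2,\Lambda)$ be the set of those targets in $\mathcal F_D^{d,T}$ that have components $F_0,f_i,S_i$ as above such that $F_0$ is $\Lambda$-Lipschitz in the sup norm and, for every $\delta>0$, $F_0$ is uniformly $\delta$-approximated on $[0,1]^D$ by a two-layer network with $1$-Lipschitz activation, weights and biases bounded by $1$ and width at most $C_1/\delta^{\gamma_1}$, and each $f_i$ is uniformly $\delta$-approximated on $[0,1]^d$ by a two-layer network with $1$-Lipschitz activation and width at most $C_2/\delta^{\gamma_2}$. Let $\mathcal F_{D,\mathrm{ReLU}}^{d,T}(C_1,\gamma_1,C_2,\gamma_2,\Lambda)$ be defined in the same way, with all these networks being ReLU networks with weights and biases bounded by $1$. Put $\gamma=\max(\gamma_1,\gamma_2)$. **Theorem.** (1) ($D$ heads.) For all $C_1,\gamma_1,C_2,\gamma_2>0$ and $\Lambda\ge0$ there is $C>0$, depending only on $d,D,T,C_1,\gamma_1,C_2,\gamma_2,\Lambda$, such that for all $\epsilon>0$ and all integers $M>C/\epsilon^{\gamma}$ the class $\mathcal H(D,2,d,T,M)$ (that is, $h=D$ heads of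 dimension $n=2$) $\epsilon$-approximates $\mathcal F_D^{d,T}(C_1,\gamma_1,C_2,\gamma_2,\Lambda)$. In particular the exponent does not depend on $T$. (2) (Fewer than $D$ heads.) Let $1\le s<D$, $n\ge1$ and $$k=\frac{\frac14T-s-D+1}{(n+1)s+1}-1 .$$ For every nonempty $\mathcal F\subseteq\mathcal F_D^{d,T}$ (in particular for a single target), $$\min\{M\ge1:\ \mathcal H(s,n,d,T,M)\ \epsilon\text{-approximates }\mathcal F\}=\Omega(1/\epsilon^k)\qquad(\epsilon\to0),$$ where the minimum of the empty set is $+\infty$. The same bound, with the same constants, holds when the encoder $P_\phi$ may have any number of layers. (3) (One head, large embedding dimension.) Let $\mathcal H'(1,n,d,T,M)$ be defined like $\mathcal H(1,n,d,T,M)$, but with a five-layer ReLU feed-forward block $\hat F$ (weights and biases still bounded by $1$) and a two-layer ReLU encoder. For all $C_1,\gamma_1,C_2,\gamma_2>0$ and $\Lambda\ge0$ there is $C>0$, depending only on $d,D,T,C_1,\gamma_1,C_2,\gamma_2,\Lambda$, such that for all $n\ge Td$, all $\epsilon>0$ and all integers $M>C/\epsilon^{1+\gamma}$ the class $\mathcal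 H'(1,n,d,T,M)$ $\epsilon$-approximates $\mathcal F_{D,\mathrm{ReLU}}^{d,T}(C_1,\gamma_1,C_2,\gamma_2,\Lambda)$. -/

import Mathlib

open scoped NNReal Matrix

noncomputable section

namespace TransformerRates

/-! ### Feed-forward networks -/

/-- `FFN l L m` is the type of fully connected feed-forward networks with `L` layers, input
dimension `m` and output dimension `l`. An `L`-layer network consists of `L` affine maps; the
activation is applied coordinatewise after each of them except the last one, so there are `L - 1`
hidden layers. -/
inductive FFN (l : ℕ) : ℕ → ℕ → Type
  | output {m : ℕ} (A : Matrix (Fin l) (Fin m) ℝ) (b : Fin l → ℝ) : FFN l 1 m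
  | layer {L m p : ℕ} (A : Matrix (Fin p) (Fin m) ℝ) (b : Fin p → ℝ) (N : FFN l L p) :
      FFN l (L + 1) m

/-- The function computed by a network with activation `σ`. -/
def FFN.eval (σ : ℝ → ℝ) {l : ℕ} : {L m : ℕ} → FFN l L m → (Fin m → ℝ) → (Fin l → ℝ)
  | _, _, .output A b, x => A *ᵥ x + b
  | _, _, .layer A b N, x => N.eval σ (fun r => σ ((A *ᵥ x + b) r))

/-- The number of nonzero entries of a weight matrix and a bias vector. -/
def nonzeroCount {p m : ℕ} (A : Matrix (Fin p) (Fin m) ℝ) (b : Fin p → ℝ) : ℕ :=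
  Set.ncard {q : Fin p × Fin m | A q.1 q.2 ≠ 0} + Set.ncard {r : Fin p | b r ≠ 0}

/-- The parameter count of a network: the number of its nonzero weights and biases. -/
def FFN.paramCount {l : ℕ} : {L m : ℕ} → FFN l L m → ℕ
  | _, _, .output A b => nonzeroCount A b
  | _, _, .layer A b N => nonzeroCount A b + N.paramCount

/-- The width of a network: the largest number of units in a hidden layer. -/
def FFN.width {l : ℕ} : {L m : ℕ} → FFN l L m → ℕ
  | _, _, .output _ _ => 0
  | _, _, .layer (p := p) _ _ N => max p N.width

/-- All weights and biases of the network lie in `W`. -/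
def FFN.WeightsIn (W : Set ℝ) {l : ℕ} : {L m : ℕ} → FFN l L m → Prop
  | _, _, .output A b => (∀ r j, A r j ∈ W) ∧ ∀ r, b r ∈ W
  | _, _, .layer A b N => ((∀ r j, A r j ∈ W) ∧ ∀ r, b r ∈ W) ∧ N.WeightsIn W

/-- The weights bounded in magnitude by `1`. -/
def unitWeights : Set ℝ := Set.Icc (-1) 1

/-- The `1`-Lipschitz activations. -/
def lipschitzActivations : Set (ℝ → ℝ) := {σ | LipschitzWith 1 σ}

/-- The ReLU activation. -/
def relu (u : ℝ) : ℝ := max u 0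

/-- The cube `[0,1]^m`. -/
def cube (m : ℕ) : Set (Fin m → ℝ) := Set.Icc 0 1

/-- For every `δ > 0`, the function `g` is uniformly `δ`-approximated on `[0,1]^m` by a two-layer
network of width at most `C / δ ^ γ` with weights in `W` and an activation in `𝒜`. -/
def ApproxAtRate (𝒜 : Set (ℝ → ℝ)) (W : Set ℝ) (C γ : ℝ) {m : ℕ} (g : (Fin m → ℝ) → ℝ) : Prop :=
  ∀ δ : ℝ, 0 < δ → ∃ σ ∈ 𝒜, ∃ N : FFN 1 2 m,
    N.WeightsIn W ∧ (N.width : ℝ) ≤ C / δ ^ γ ∧ ∀ x ∈ cube m, |g x - N.eval σ x 0| ≤ δ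

/-! ### Single-layer transformers -/

/-- The input space `𝒳_T`: sequences of `T` tokens in `[0,1]^d`. -/
def inputSpace (d T : ℕ) : Set (Fin T → Fin d → ℝ) := {X | ∀ t, X t ∈ cube d}

/-- The softmax of the scores `ρ` with scaling factor `β`. -/
def softmax (β : ℝ) {T : ℕ} (ρ : Fin T → ℝ) (t : Fin T) : ℝ :=
  Real.exp (β * ρ t) / ∑ t', Real.exp (β * ρ t')

/-- The attention layer with `h` heads of dimension `n` (total embedding dimension `E = h * n`),
together with the classification token `c₀` and the softmax scaling factor `β`. -/
structure Attention (h n : ℕ) where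
  WQ : Fin h → Matrix (Fin n) (Fin (h * n)) ℝ
  WK : Fin h → Matrix (Fin n) (Fin (h * n)) ℝ
  WV : Fin h → Matrix (Fin n) (Fin (h * n)) ℝ
  WO : Matrix (Fin (h * n)) (Fin (h * n)) ℝ
  c₀ : Fin (h * n) → ℝ
  β : ℝ

namespace Attention

variable {h n : ℕ}

/-- The softmax scaling factor is positive and the entries of all projection matrices are bounded in
magnitude by `1`. -/
def Admissible (a : Attention h n) : Prop :=
  0 < a.β ∧
  (∀ i r j, |a.WQ i r j| ≤ 1) ∧ (∀ i r j, |a.WK i r j| ≤ 1) ∧ (∀ i r j, |a.WV i r j| ≤ 1) ∧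
  ∀ r j, |a.WO r j| ≤ 1

/-- The output of head `i` on the embedded tokens `e`. -/
def head (a : Attention h n) {T : ℕ} (e : Fin T → Fin (h * n) → ℝ) (i : Fin h) : Fin n → ℝ :=
  ∑ t, softmax a.β (fun t' => (a.WQ i *ᵥ a.c₀) ⬝ᵥ (a.WK i *ᵥ e t')) t • (a.WV i *ᵥ e t)

/-- The concatenation of the head outputs. -/
def concatHeads (a : Attention h n) {T : ℕ} (e : Fin T → Fin (h * n) → ℝ) : Fin (h * n) → ℝ :=
  fun q => a.head e (finProdFinEquiv.symm q).1 (finProdFinEquiv.symm q).2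

/-- The vector at the position of the classification token after the attention layer. -/
def out (a : Attention h n) {T : ℕ} (e : Fin T → Fin (h * n) → ℝ) : Fin (h * n) → ℝ :=
  a.c₀ + a.WO *ᵥ a.concatHeads e

end Attention

/-- The encoder `P_φ : [0,1]^d × [T] → ℝ^E` given by a network that reads the token `x` together with
the one-hot code of its position `t`. -/
def encode (σ : ℝ → ℝ) {E ℓ d T : ℕ} (P : FFN E ℓ (d + T)) (x : Fin d → ℝ) (t : Fin T) : Fin E → ℝ :=
  P.eval σ (Fin.append x (Pi.single t 1))

/-- The hypothesis class `ℋ(h, n, d, T, M)` of single-layer transformers `H : [0,1]^{d × T} → ℝ` with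
`h` heads, per-head dimension `n` and at most `M` parameters in the encoder `P_φ` and the
feed-forward block `G`. The encoder is an `ℓ`-layer network with `‖P_φ(x, t)‖₂ ≤ 1`, the feed-forward
block is an `L`-layer network with weights bounded by `1`, the attention matrices have entries
bounded by `1`, and the activations of the two networks belong to `𝒜`. -/
def hypothesisClass (𝒜 : Set (ℝ → ℝ)) (ℓ L h n d T M : ℕ) : Set ((Fin T → Fin d → ℝ) → ℝ) :=
  {H | ∃ σ ∈ 𝒜, ∃ τ ∈ 𝒜, ∃ (P : FFN (h * n) ℓ (d + T)) (a : Attention h n) (G : FFN 1 L (h * n)),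
    (∀ x ∈ cube d, ∀ t : Fin T, √(∑ q, encode σ P x t q ^ 2) ≤ 1) ∧
    a.Admissible ∧
    G.WeightsIn unitWeights ∧
    P.paramCount + G.paramCount ≤ M ∧
    H = fun X => G.eval τ (a.out fun t => encode σ P (X t) t) 0}

/-- The hypothesis class `ℋ` `ε`-approximates every function of the class `𝓕`: for each `F ∈ 𝓕`
there is `H ∈ ℋ` with `sup_{X ∈ 𝒳_T} |H X - F X| < ε`. -/
def EpsApproximates {d T : ℕ} (ℋ : Set ((Fin T → Fin d → ℝ) → ℝ)) (ε : ℝ)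
    (𝓕 : Set ((Fin T → Fin d → ℝ) → ℝ)) : Prop :=
  ∀ F ∈ 𝓕, ∃ H ∈ ℋ, ∃ η < ε, ∀ X ∈ inputSpace d T, |H X - F X| ≤ η

/-! ### Generalized `D`-retrieval tasks -/

/-- The target `X ↦ F₀ (z̄₁(X), …, z̄_D(X))` with `z̄ᵢ(X) = min_{t ∈ Sᵢ} fᵢ(x(t))`. -/
def retrievalTarget {d T D : ℕ} (F₀ : (Fin D → ℝ) → ℝ) (f : Fin D → (Fin d → ℝ) → ℝ)
    (S : Fin D → Finset (Fin T)) (X : Fin T → Fin d → ℝ) : ℝ :=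
  F₀ fun i => ⨅ t : {t // t ∈ S i}, f i (X t)

/-- The conditions on the components `F₀`, `fᵢ`, `Sᵢ` of a generalized `D`-retrieval task, with
minimizers `xmin i`. Derivatives at boundary points are taken within the cube. -/
structure IsRetrievalTask {d T D : ℕ} (F₀ : (Fin D → ℝ) → ℝ) (f : Fin D → (Fin d → ℝ) → ℝ)
    (S : Fin D → Finset (Fin T)) (xmin : Fin D → Fin d → ℝ) : Prop where
  contDiffOn_outer : ContDiffOn ℝ 1 F₀ (cube D)
  contDiffOn_comp : ∀ i, ContDiffOn ℝ 2 (f i) (cube d)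
  mapsTo_comp : ∀ i, Set.MapsTo (f i) (cube d) (Set.Icc 0 1)
  quarter_le_card : ∀ i, (T : ℝ) / 4 ≤ (S i).card
  xmin_mem : ∀ i, xmin i ∈ cube d
  unique_min : ∀ i, ∀ y ∈ cube d, y ≠ xmin i → f i (xmin i) < f i y
  xmin_injective : Function.Injective xmin
  hessian_posDef : ∀ i, ∀ v : Fin d → ℝ, v ≠ 0 →
    0 < iteratedFDerivWithin ℝ 2 (f i) (cube d) (xmin i) ![v, v]
  partial_ne_zero : ∀ i : Fin D,
    fderivWithin ℝ F₀ (cube D) (fun j => f j (xmin j)) (Pi.single i 1) ≠ 0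

/-- The target class `ℱ_D^{d,T}`. -/
def targetClass (d T D : ℕ) : Set ((Fin T → Fin d → ℝ) → ℝ) :=
  {H | ∃ F₀ f S xmin, IsRetrievalTask (d := d) (T := T) (D := D) F₀ f S xmin ∧
    H = retrievalTarget F₀ f S}

/-- The functions of the class `ℱ_D^{d,T}` whose components satisfy the approximation assumptions
with given constants: `F₀` is approximated at rate `(C₁, γ₁)` by networks with weights bounded by
`1`, each `fᵢ` at rate `(C₂, γ₂)` by networks with weights in `W`, all with activations in `𝒜`, and
`Λ` is a Lipschitz constant of `F₀` on the cube. -/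
def approxTargetClass (𝒜 : Set (ℝ → ℝ)) (W : Set ℝ) (d T D : ℕ) (C₁ γ₁ C₂ γ₂ : ℝ) (Λ : ℝ≥0) :
    Set ((Fin T → Fin d → ℝ) → ℝ) :=
  {H | ∃ F₀ f S xmin, IsRetrievalTask (d := d) (T := T) (D := D) F₀ f S xmin ∧
    LipschitzOnWith Λ F₀ (cube D) ∧
    ApproxAtRate 𝒜 unitWeights C₁ γ₁ F₀ ∧
    (∀ i, ApproxAtRate 𝒜 W C₂ γ₂ (f i)) ∧
    H = retrievalTarget F₀ f S}

end TransformerRates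

end

/-!
With `D` heads, head `i` uses the scores `-(fᵢ + penalty off Sᵢ)`. As the inverse temperature grows,
its softmax average of the values of `fᵢ` tends to the minimum of `fᵢ` over `Sᵢ`, and the
feed-forward block only has to approximate `F₀`.

With fewer than `D` heads, some component `fᵢ` owns none of the tokens that dominate the scores of
the heads. Fixing these few dominating tokens bounds the softmax weights of all other positions of
`Sᵢ`, where `fᵢ` can still be set to any of `q` levels. The unnormalized sums of the heads,
`(n + 1) s` real numbers, take nearly equal values for two of these exponentially many
configurations. The target separates the two, the attention layer barely does, and the Lipschitz
constant of the feed-forward block is at most its number of parameters.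

One head of dimension at least `T d` can store the tokens in disjoint blocks, so that averaging them
concatenates the whole input. Two ReLU layers then compute a minimum to precision `1 / N` by
comparing with the `N` thresholds `k / N`, at the cost of the additional factor `1 / ε`.
-/

noncomputable section

namespace TransformerRates

/-! ### Networks with arbitrary index types -/

section Networks

variable {ι κ o : Type}

/-- Some `L`-layer network with weights in `W` and at most `c` parameters computes the map `g`,
whichever enumerations of the input and output coordinates are used. Allowing arbitrary index types
makes it possible to label hidden units by pairs and sums. -/
def Realizes (σ : ℝ → ℝ) (W : Set ℝ) (L c : ℕ) (g : (ι → ℝ) → o → ℝ) : Prop :=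
  ∀ ⦃m l : ℕ⦄ (e : ι ≃ Fin m) (f : o ≃ Fin l), ∃ N : FFN l L m,
    N.WeightsIn W ∧ N.paramCount ≤ c ∧ ∀ x r, N.eval σ x (f r) = g (x ∘ e) r

/-- The number of nonzero entries of a weight matrix and a bias vector with arbitrary index
types. -/
def entryCount (A : Matrix κ ι ℝ) (b : κ → ℝ) : ℕ :=
  Set.ncard {q : κ × ι | A q.1 q.2 ≠ 0} + Set.ncard {r : κ | b r ≠ 0}

lemma nonzeroCount_submatrix {p m : ℕ} (A : Matrix κ ι ℝ) (b : κ → ℝ) (e : ι ≃ Fin m)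
    (f : κ ≃ Fin p) :
    nonzeroCount (A.submatrix f.symm e.symm) (b ∘ f.symm) = entryCount A b := by
  have ncard_symm_preimage {α β : Type} (g : α ≃ β) (s : Set α) :
      (g.symm ⁻¹' s).ncard = s.ncard := by
    rw [← g.image_eq_preimage_symm, Set.ncard_image_of_injective _ g.injective]
  exact congrArg₂ (· + ·) (ncard_symm_preimage (f.prodCongr e) {q : κ × ι | A q.1 q.2 ≠ 0})
    (ncard_symm_preimage f {r | b r ≠ 0})

lemma entryCount_le {α β : Type} [Fintype α] [Fintype β] {A : Matrix κ ι ℝ} {b : κ → ℝ}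
    (φ : α → κ × ι) (ψ : β → κ) (hA : ∀ r j, A r j ≠ 0 → (r, j) ∈ Set.range φ)
    (hb : ∀ r, b r ≠ 0 → r ∈ Set.range ψ) :
    entryCount A b ≤ Fintype.card α + Fintype.card β := by
  have ncard_le {γ δ : Type} [Fintype γ] (χ : γ → δ) (s : Set δ) (hs : s ⊆ Set.range χ) :
      s.ncard ≤ Fintype.card γ := by
    refine (Set.ncard_le_ncard hs (Set.finite_range χ)).trans ?_
    rw [← Set.image_univ, ← Nat.card_eq_fintype_card, ← Set.ncard_univ]
    exact Set.ncard_image_le Set.finite_univ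
  exact add_le_add (ncard_le φ _ fun q => hA q.1 q.2) (ncard_le ψ _ hb)

lemma entryCount_le_card [Fintype ι] [Fintype κ] (A : Matrix κ ι ℝ) (b : κ → ℝ) :
    entryCount A b ≤ Fintype.card κ * Fintype.card ι + Fintype.card κ := by
  rw [← Fintype.card_prod]
  exact entryCount_le id id (by simp) (by simp)

variable {σ : ℝ → ℝ} {W : Set ℝ} {L c c' : ℕ}

lemma Realizes.mono {g : (ι → ℝ) → o → ℝ} (h : Realizes σ W L c g) (hc : c ≤ c') :
    Realizes σ W L c' g := fun _ _ e f =>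
  let ⟨N, hW, hN, heval⟩ := h e f
  ⟨N, hW, hN.trans hc, heval⟩

variable [Fintype ι]

lemma Realizes.output {A : Matrix o ι ℝ} {b : o → ℝ} (hA : ∀ r j, A r j ∈ W) (hb : ∀ r, b r ∈ W)
    (hc : entryCount A b ≤ c) : Realizes σ W 1 c fun x => A *ᵥ x + b := by
  intro m l e f
  refine ⟨.output (A.submatrix f.symm e.symm) (b ∘ f.symm), ⟨fun _ _ => hA _ _, fun _ => hb _⟩,
    (nonzeroCount_submatrix A b e f).trans_le hc, fun x r => ?_⟩
  simp [FFN.eval, Matrix.submatrix_mulVec_equiv]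

lemma Realizes.layer [Finite κ] {g : (κ → ℝ) → o → ℝ} (h : Realizes σ W L c' g)
    {A : Matrix κ ι ℝ} {b : κ → ℝ} (hA : ∀ r j, A r j ∈ W) (hb : ∀ r, b r ∈ W)
    (hc : entryCount A b ≤ c) :
    Realizes σ W (L + 1) (c + c') fun x => g (σ ∘ (A *ᵥ x + b)) := by
  intro m l e f
  let k := Finite.equivFin κ
  obtain ⟨N, hW, hN, heval⟩ := h k f
  refine ⟨.layer (A.submatrix k.symm e.symm) (b ∘ k.symm) N,
    ⟨⟨fun _ _ => hA _ _, fun _ => hb _⟩, hW⟩,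
    add_le_add ((nonzeroCount_submatrix A b e k).trans_le hc) hN, fun x r => ?_⟩
  rw [FFN.eval, heval]
  congr 1
  ext q
  simp [Matrix.submatrix_mulVec_equiv]

lemma append_single_comp_finSumFinEquiv {d T : ℕ} (x : Fin d → ℝ) (t : Fin T) :
    Fin.append x (Pi.single t (1 : ℝ)) ∘ finSumFinEquiv = Sum.elim x (Pi.single t 1) := by
  ext (j | t') <;> simp

lemma Realizes.exists_encoder {d T ℓ E : ℕ} {g : (Fin d ⊕ Fin T → ℝ) → o → ℝ}
    (h : Realizes σ W ℓ c g) (f : o ≃ Fin E) :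
    ∃ P : FFN E ℓ (d + T), P.paramCount ≤ c ∧
      ∀ x (t : Fin T) r, encode σ P x t (f r) = g (Sum.elim x (Pi.single t 1)) r := by
  obtain ⟨P, -, hP, heval⟩ := h finSumFinEquiv f
  refine ⟨P, hP, fun x t r => ?_⟩
  rw [encode, heval, append_single_comp_finSumFinEquiv]

/-! ### Shallow networks -/

/-- A two-layer network with scalar output, input coordinates indexed by `ι` and hidden units
indexed by `Fin width`; the activation is supplied when the network is evaluated. -/
structure ShallowNet (ι : Type) where
  width : ℕ
  inner : Matrix (Fin width) ι ℝ
  bias : Fin width → ℝ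
  outer : Fin width → ℝ
  const : ℝ

/-- The function computed by a shallow network with activation `σ`. -/
def ShallowNet.eval (σ : ℝ → ℝ) (N : ShallowNet ι) (x : ι → ℝ) : ℝ :=
  N.outer ⬝ᵥ (σ ∘ (N.inner *ᵥ x + N.bias)) + N.const

/-- All weights and biases of a shallow network lie in `W`. -/
structure ShallowNet.WeightsIn (W : Set ℝ) (N : ShallowNet ι) : Prop where
  inner_mem : ∀ r j, N.inner r j ∈ W
  bias_mem : ∀ r, N.bias r ∈ W
  outer_mem : ∀ r, N.outer r ∈ W
  const_mem : N.const ∈ W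

lemma ApproxAtRate.exists_shallowNet {𝒜 : Set (ℝ → ℝ)} {C γ : ℝ} {m : ℕ} {g : (Fin m → ℝ) → ℝ}
    (h : ApproxAtRate 𝒜 W C γ g) {δ : ℝ} (hδ : 0 < δ) :
    ∃ σ ∈ 𝒜, ∃ N : ShallowNet (Fin m), N.WeightsIn W ∧ (N.width : ℝ) ≤ C / δ ^ γ ∧
      ∀ x ∈ cube m, |g x - N.eval σ x| ≤ δ := by
  obtain ⟨σ, hσ, N, hW, hwidth, happrox⟩ := h δ hδ
  match N with
  | .layer A b (.output A' b') =>
    obtain ⟨⟨hA, hb⟩, hA', hb'⟩ := hW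
    refine ⟨σ, hσ, ⟨_, A, b, A' 0, b' 0⟩, ⟨hA, hb, hA' 0, hb' 0⟩, ?_, fun x hx => ?_⟩
    · simpa [FFN.width] using hwidth
    · exact happrox x hx

/-- The shallow network computing `k * N + e`. -/
def ShallowNet.affine (N : ShallowNet ι) (k e : ℝ) : ShallowNet ι :=
  { N with outer := k • N.outer, const := k * N.const + e }

lemma ShallowNet.eval_affine (N : ShallowNet ι) (k e : ℝ) (x : ι → ℝ) :
    (N.affine k e).eval σ x = k * N.eval σ x + e := by
  change (k • N.outer) ⬝ᵥ (σ ∘ (N.inner *ᵥ x + N.bias)) + (k * N.const + e) = _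
  rw [smul_dotProduct, smul_eq_mul, eval]
  ring

/-- The shallow network that ignores the coordinates of its input indexed by `κ`. -/
def ShallowNet.ignoreRight (N : ShallowNet ι) (κ : Type) : ShallowNet (ι ⊕ κ) :=
  { N with inner := Matrix.fromCols N.inner 0 }

lemma ShallowNet.eval_ignoreRight [Fintype κ] (N : ShallowNet ι) (x : ι → ℝ) (y : κ → ℝ) :
    (N.ignoreRight κ).eval σ (Sum.elim x y) = N.eval σ x := by
  change N.outer ⬝ᵥ (σ ∘ (Matrix.fromCols N.inner 0 *ᵥ Sum.elim x y + N.bias)) + N.const = _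
  rw [Matrix.fromCols_mulVec]
  simp [eval]

/-- The shallow network that replaces each input coordinate of `N` by the sum of a family of
coordinates indexed by `κ`. -/
def ShallowNet.sumFibers (N : ShallowNet ι) (κ : Type) : ShallowNet (ι × κ) :=
  { N with inner := N.inner.submatrix id Prod.fst }

lemma ShallowNet.eval_sumFibers [Fintype κ] (N : ShallowNet ι) (x : ι × κ → ℝ) :
    (N.sumFibers κ).eval σ x = N.eval σ fun i => ∑ k, x (i, k) := by
  have hinner : N.inner.submatrix id Prod.fst *ᵥ x = N.inner *ᵥ fun i => ∑ k, x (i, k) := by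
    ext r
    simp [Matrix.mulVec, dotProduct, Fintype.sum_prod_type, Finset.mul_sum]
  change N.outer ⬝ᵥ (σ ∘ (N.inner.submatrix id Prod.fst *ᵥ x + N.bias)) + N.const = _
  rw [hinner, eval]

/-- The shallow network that reads the coordinate `k` of each family of coordinates. -/
def ShallowNet.readAt [DecidableEq κ] (N : ShallowNet ι) (k : κ) : ShallowNet (ι × κ) :=
  { N with inner := Matrix.of fun r q => if q.2 = k then N.inner r q.1 else 0 }

lemma ShallowNet.eval_readAt [Fintype κ] [DecidableEq κ] (N : ShallowNet ι) (k : κ)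
    (x : ι × κ → ℝ) : (N.readAt k).eval σ x = N.eval σ fun i => x (i, k) := by
  have hinner : (Matrix.of fun r q => if q.2 = k then N.inner r q.1 else 0 :
      Matrix (Fin N.width) (ι × κ) ℝ) *ᵥ x = N.inner *ᵥ fun i => x (i, k) := by
    ext r
    simp [Matrix.mulVec, dotProduct, Fintype.sum_prod_type, ite_mul]
  change N.outer ⬝ᵥ (σ ∘ (Matrix.of (fun r q => if q.2 = k then N.inner r q.1 else 0) *ᵥ x +
    N.bias)) + N.const = _
  rw [hinner, eval]

end Networks

section ShallowNetWeights

variable {ι κ : Type} {W : Set ℝ} {N : ShallowNet ι}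

lemma ShallowNet.WeightsIn.sumFibers (h : N.WeightsIn W) : (N.sumFibers κ).WeightsIn W :=
  ⟨fun r q => h.inner_mem r q.1, h.bias_mem, h.outer_mem, h.const_mem⟩

lemma ShallowNet.WeightsIn.readAt [DecidableEq κ] (h : N.WeightsIn W) (h0 : (0 : ℝ) ∈ W) (k : κ) :
    (N.readAt k).WeightsIn W := by
  refine ⟨fun r q => ?_, h.bias_mem, h.outer_mem, h.const_mem⟩
  change (if q.2 = k then N.inner r q.1 else 0) ∈ W
  split_ifs
  exacts [h.inner_mem r q.1, h0]

end ShallowNetWeights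

section Zero

variable {ι κ o : Type} {σ : ℝ → ℝ} {W : Set ℝ}

lemma Realizes.zero [Finite ι] (h0 : (0 : ℝ) ∈ W) (L : ℕ) :
    Realizes σ W (L + 1) 0 fun (_ : ι → ℝ) (_ : o) => (0 : ℝ) := by
  have hcount {ι κ : Type} : entryCount (0 : Matrix κ ι ℝ) 0 ≤ 0 := by simp [entryCount]
  induction L generalizing ι with
  | zero =>
    have := Fintype.ofFinite ι
    convert Realizes.output (σ := σ) (A := (0 : Matrix o ι ℝ)) (fun _ _ => h0) (fun _ => h0) hcount
    simp
  | succ L ih =>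
    have := Fintype.ofFinite ι
    exact (ih (ι := Empty)).layer (A := 0) (b := 0) (fun _ _ => h0) (fun _ => h0) hcount

lemma zero_mem_unitWeights : (0 : ℝ) ∈ unitWeights := by simp [unitWeights]

lemma abs_le_one_of_mem_unitWeights {w : ℝ} (hw : w ∈ unitWeights) : |w| ≤ 1 := abs_le.2 hw

lemma zero_mem_hypothesisClass {𝒜 : Set (ℝ → ℝ)} (h𝒜 : 𝒜.Nonempty) (ℓ L h n d T M : ℕ) :
    (fun _ => 0) ∈ hypothesisClass 𝒜 (ℓ + 1) (L + 1) h n d T M := by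
  obtain ⟨σ, hσ⟩ := h𝒜
  obtain ⟨P, hP, hPeval⟩ := (Realizes.zero (σ := σ) (W := unitWeights) (o := Fin (h * n))
    zero_mem_unitWeights ℓ).exists_encoder (d := d) (T := T) (Equiv.refl _)
  obtain ⟨G, hGW, hG, hGeval⟩ := Realizes.zero (σ := σ) (o := Fin 1) zero_mem_unitWeights L
    (Equiv.refl (Fin (h * n))) (Equiv.refl _)
  refine ⟨σ, hσ, σ, hσ, P, ⟨0, 0, 0, 0, 0, 1⟩, G, fun x _ t => ?_, by simp [Attention.Admissible],
    hGW, by omega, ?_⟩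
  · have hzero : ∀ q, encode σ P x t q = 0 := hPeval x t
    simp [hzero]
  · exact funext fun X => (hGeval _ 0).symm

end Zero

/-! ### Parallel composition -/

section Parallel

lemma abs_sub_le_of_lipschitzWith {σ : ℝ → ℝ} (h : LipschitzWith 1 σ) (x y : ℝ) :
    |σ x - σ y| ≤ |x - y| := by
  simpa [Real.dist_eq] using h.dist_le_mul x y

lemma exists_lipschitz_factor {α : Type*} (φ ψ : α → ℝ) (h : ∀ a b, |ψ a - ψ b| ≤ |φ a - φ b|) :
    ∃ τ : ℝ → ℝ, LipschitzWith 1 τ ∧ ∀ a, τ (φ a) = ψ a := by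
  have hext : ∀ a, Function.extend φ ψ 0 (φ a) = ψ a := by
    refine fun a => Function.FactorsThrough.extend_apply (fun a b hab => sub_eq_zero.1 ?_) _ a
    simpa [hab] using h a b
  have hlip : LipschitzOnWith 1 (Function.extend φ ψ 0) (Set.range φ) := by
    refine LipschitzOnWith.of_dist_le_mul ?_
    rintro _ ⟨a, rfl⟩ _ ⟨b, rfl⟩
    simpa [hext, Real.dist_eq] using h a b
  obtain ⟨τ, hτ, heq⟩ := hlip.extend_real
  exact ⟨τ, hτ, fun a => by rw [← heq ⟨a, rfl⟩, hext]⟩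

lemma exists_separated {o : Type} [Finite o] {B : ℝ} (hB : 0 ≤ B) :
    ∃ s : o → ℝ, (∀ i, s i ∈ Set.Icc 0 (B * Nat.card o)) ∧ ∀ i j, i ≠ j → B ≤ |s i - s j| := by
  let e := Finite.equivFin o
  refine ⟨fun i => B * (e i : ℕ), fun i => ⟨by positivity, ?_⟩, fun i j hij => ?_⟩
  · exact mul_le_mul_of_nonneg_left (Nat.cast_le.2 (e i).2.le) hB
  have hne : (e i : ℤ) ≠ e j := by
    rw [Nat.cast_injective.ne_iff, Fin.val_injective.ne_iff]
    exact e.injective.ne hij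
  have hone : (1 : ℝ) ≤ |((e i : ℕ) : ℝ) - (e j : ℕ)| := by
    exact_mod_cast Int.one_le_abs (sub_ne_zero.2 hne)
  rw [← mul_sub, abs_mul, abs_of_nonneg hB]
  exact le_mul_of_one_le_right hB hone

-- The graphs of the functions `σ i - σ i 0` over `[-B, B]` are put side by side with gaps of length
-- `2 * B`, and a `1`-Lipschitz function is interpolated between them.
lemma exists_common_activation {o : Type} [Finite o] (σ : o → ℝ → ℝ)
    (hσ : ∀ i, LipschitzWith 1 (σ i)) {B : ℝ} (hB : 0 ≤ B) :
    ∃ (τ : ℝ → ℝ) (s : o → ℝ), LipschitzWith 1 τ ∧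
      ∀ i u, |u| ≤ B → τ (u + s i) = σ i u - σ i 0 := by
  obtain ⟨s, -, hs⟩ := exists_separated (o := o) (mul_nonneg zero_le_four hB)
  obtain ⟨τ, hτ, hfactor⟩ := exists_lipschitz_factor (α := o × Set.Icc (-B) B)
    (fun a => a.2.1 + s a.1) (fun a => σ a.1 a.2.1 - σ a.1 0) (by
      rintro ⟨i, u, hu⟩ ⟨j, v, hv⟩
      by_cases hij : i = j
      · subst hij
        simpa using abs_sub_le_of_lipschitzWith (hσ i) u v
      have hu' : |σ i u - σ i 0| ≤ B := by
        simpa using (abs_sub_le_of_lipschitzWith (hσ i) u 0).trans (by simpa using abs_le.2 hu)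
      have hv' : |σ j v - σ j 0| ≤ B := by
        simpa using (abs_sub_le_of_lipschitzWith (hσ j) v 0).trans (by simpa using abs_le.2 hv)
      have hgap : 4 * B ≤ |u + s i - (v + s j)| + (|v| + |u|) := by
        calc 4 * B ≤ |s i - s j| := hs i j hij
          _ = |u + s i - (v + s j) + (v - u)| := by ring_nf
          _ ≤ _ := (abs_add_le _ _).trans (add_le_add_right (abs_sub v u) _)
      linarith [abs_sub (σ i u - σ i 0) (σ j v - σ j 0), abs_le.2 hu, abs_le.2 hv])
  exact ⟨τ, s, hτ, fun i u hu => hfactor (i, ⟨u, abs_le.1 hu⟩)⟩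

lemma abs_mulVec_add_le {ι κ : Type} [Fintype ι] (A : Matrix κ ι ℝ) (b : κ → ℝ) {x : ι → ℝ}
    (hx : ∀ j, |x j| ≤ 1) (r : κ) : |(A *ᵥ x + b) r| ≤ (∑ j, |A r j|) + |b r| := by
  refine (abs_add_le _ _).trans (add_le_add_left ((Finset.abs_sum_le_sum_abs _ _).trans ?_) _)
  refine Finset.sum_le_sum fun j _ => ?_
  rw [abs_mul]
  exact mul_le_of_le_one_right (abs_nonneg _) (hx j)

lemma exists_realizes_shallowNets {ι o : Type} [Fintype ι] [Fintype o]
    (N : o → ShallowNet ι) (σ : o → ℝ → ℝ) (hσ : ∀ q, LipschitzWith 1 (σ q)) :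
    ∃ (τ : ℝ → ℝ) (g : (ι → ℝ) → o → ℝ), LipschitzWith 1 τ ∧
      Realizes τ Set.univ 2 ((∑ q, (N q).width) *
        (Fintype.card ι + 1 + Fintype.card o) + Fintype.card o) g ∧
      ∀ x, (∀ j, |x j| ≤ 1) → ∀ q, g x q = (N q).eval (σ q) x := by
  classical
  let κ := (q : o) × Fin (N q).width
  let A : Matrix κ ι ℝ := Matrix.of fun k => (N k.1).inner k.2
  let b : κ → ℝ := fun k => (N k.1).bias k.2
  obtain ⟨B, hB⟩ := (Set.finite_range fun k => (∑ j, |A k j|) + |b k|).bddAbove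
  obtain ⟨τ, s, hτ, hτs⟩ := exists_common_activation σ hσ (le_max_right B 0)
  have hhidden : ∀ x, (∀ j, |x j| ≤ 1) → ∀ k : κ, τ ((A *ᵥ x + fun k => b k + s k.1) k) =
      σ k.1 ((A *ᵥ x + b) k) - σ k.1 0 := by
    intro x hx k
    rw [← hτs k.1 _ ((abs_mulVec_add_le A b hx k).trans ((hB ⟨k, rfl⟩).trans (le_max_left _ _)))]
    simp [add_assoc]
  let A' : Matrix o κ ℝ := Matrix.of fun q k => if k.1 = q then (N k.1).outer k.2 else 0
  let b' : o → ℝ := fun q => (N q).const + ∑ r, (N q).outer r * σ q 0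
  have hrealizes := (Realizes.output (σ := τ) (W := Set.univ) (A := A') (b := b')
    (fun _ _ => trivial) (fun _ => trivial) (entryCount_le_card _ _)).layer
    (A := A) (b := fun k => b k + s k.1) (fun _ _ => trivial) (fun _ => trivial)
    (entryCount_le_card _ _)
  refine ⟨τ, _, hτ, hrealizes.mono ?_, fun x hx q => ?_⟩
  · simp only [κ, Fintype.card_sigma, Fintype.card_fin]
    exact le_of_eq (by ring)
  · have hsplit : (A' *ᵥ (τ ∘ (A *ᵥ x + fun k => b k + s k.1))) q =
        ∑ r, (N q).outer r * (σ q (((N q).inner *ᵥ x + (N q).bias) r) - σ q 0) := by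
      calc (A' *ᵥ (τ ∘ (A *ᵥ x + fun k => b k + s k.1))) q
          = ∑ k : κ, (if k.1 = q then (N k.1).outer k.2 else 0) *
              (σ k.1 ((A *ᵥ x + b) k) - σ k.1 0) :=
            Finset.sum_congr rfl fun k _ => congrArg (_ * ·) (hhidden x hx k)
        _ = _ := by
            rw [Fintype.sum_sigma, Finset.sum_eq_single q (fun j _ hj => by simp [hj]) (by simp)]
            simp only [if_true]
            rfl
    rw [Pi.add_apply, hsplit]
    simp only [mul_sub, Finset.sum_sub_distrib]
    exact sub_add_add_cancel _ _ _

end Parallel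

/-! ### Rescaled activations -/

section Rescaling

/-- The rescaled activation `u ↦ σ (K u) / K`, which is as Lipschitz as `σ` itself. -/
def rescale (K : ℝ) (σ : ℝ → ℝ) (u : ℝ) : ℝ := σ (K * u) / K

lemma lipschitzWith_rescale {σ : ℝ → ℝ} {c : ℝ≥0} (hσ : LipschitzWith c σ) {K : ℝ} (hK : 0 < K) :
    LipschitzWith c (rescale K σ) := by
  refine LipschitzWith.of_dist_le_mul fun u v => ?_
  have hdist : |σ (K * u) - σ (K * v)| ≤ c * |K * u - K * v| := hσ.dist_le_mul _ _
  rw [← mul_sub, abs_mul, abs_of_pos hK] at hdist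
  rw [Real.dist_eq, Real.dist_eq, rescale, rescale, ← sub_div, abs_div, abs_of_pos hK,
    div_le_iff₀ hK]
  linarith

lemma rescale_mulVec_add {ι κ : Type} [Fintype ι] (σ : ℝ → ℝ) {K : ℝ} (hK : K ≠ 0)
    (A : Matrix κ ι ℝ) (b : κ → ℝ) (x : ι → ℝ) (r : κ) :
    rescale K σ ((A *ᵥ x + fun r => b r / K) r) = σ ((A *ᵥ (K • x) + b) r) / K := by
  rw [rescale, Pi.add_apply, mul_add, mul_div_cancel₀ _ hK, Matrix.mulVec_smul]
  rfl

lemma div_mem_unitWeights {w K : ℝ} (h : |w| ≤ K) : w / K ∈ unitWeights := by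
  have hK : 0 ≤ K := (abs_nonneg w).trans h
  rw [unitWeights, Set.mem_Icc, ← abs_le, abs_div, abs_of_nonneg hK]
  exact div_le_one_of_le₀ h hK

end Rescaling

section RescaledLayers

variable {ι κ o : Type} [Fintype ι] {σ : ℝ → ℝ} {W : Set ℝ} {L c c' : ℕ}

lemma Realizes.rescaledLayer [Finite κ] {K : ℝ} (hK : K ≠ 0) {g : (κ → ℝ) → o → ℝ}
    (h : Realizes (rescale K σ) W L c' fun z => g (K • z)) {A : Matrix κ ι ℝ} {b : κ → ℝ}
    (hA : ∀ r j, A r j ∈ W) (hb : ∀ r, b r / K ∈ W) (hc : entryCount A (fun r => b r / K) ≤ c) :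
    Realizes (rescale K σ) W (L + 1) (c + c') fun x => g (σ ∘ (A *ᵥ (K • x) + b)) := by
  have hcancel : ∀ x : ι → ℝ, K • (rescale K σ ∘ (A *ᵥ x + fun r => b r / K)) =
      σ ∘ (A *ᵥ (K • x) + b) := by
    intro x
    ext r
    rw [Pi.smul_apply, Function.comp_apply, rescale_mulVec_add σ hK, smul_eq_mul,
      mul_div_cancel₀ _ hK, Function.comp_apply]
  simpa only [hcancel] using h.layer hA hb hc

-- Each hidden unit is repeated `K` times, which undoes the contraction by `K` without weights
-- larger than `1`.
lemma ShallowNet.realizes_smul (N : ShallowNet ι) (hN : N.WeightsIn unitWeights) {K : ℕ}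
    (hK : 1 ≤ K) (σ : ℝ → ℝ) :
    Realizes (rescale K σ) unitWeights 2 (N.width * K * (Fintype.card ι + 2) + 1)
      fun x (_ : Fin 1) => N.eval σ ((K : ℝ) • x) := by
  have hK0 : (K : ℝ) ≠ 0 := by positivity
  let κ := Fin N.width × Fin K
  have houtput := Realizes.output (σ := rescale K σ) (W := unitWeights)
    (A := Matrix.of fun (_ : Fin 1) (q : κ) => N.outer q.1) (b := fun _ => N.const)
    (fun _ q => hN.outer_mem q.1) (fun _ => hN.const_mem) (entryCount_le_card _ _)
  have hlayer := houtput.layer (A := N.inner.submatrix (Prod.fst : κ → _) id)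
    (b := fun q : κ => N.bias q.1 / K) (fun q j => hN.inner_mem q.1 j)
    (fun q => div_mem_unitWeights
      ((abs_le_one_of_mem_unitWeights (hN.bias_mem q.1)).trans (Nat.one_le_cast.2 hK)))
    (entryCount_le_card _ _)
  convert hlayer.mono (c' := N.width * K * (Fintype.card ι + 2) + 1) ?_ using 1
  · ext x s
    have hunit : ∀ q : κ, rescale K σ ((N.inner.submatrix (Prod.fst : κ → _) id *ᵥ x +
        fun q : κ => N.bias q.1 / K) q) = σ ((N.inner *ᵥ ((K : ℝ) • x) + N.bias) q.1) / K :=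
      fun q => rescale_mulVec_add σ hK0 N.inner N.bias x q.1
    change _ = (∑ q : κ, N.outer q.1 * rescale K σ ((N.inner.submatrix (Prod.fst : κ → _) id *ᵥ x +
      fun q : κ => N.bias q.1 / K) q)) + N.const
    rw [Fintype.sum_prod_type]
    refine congrArg (· + N.const) (Finset.sum_congr rfl fun r _ => ?_)
    calc N.outer r * σ ((N.inner *ᵥ ((K : ℝ) • x) + N.bias) r)
        = ∑ _k : Fin K, N.outer r * (σ ((N.inner *ᵥ ((K : ℝ) • x) + N.bias) r) / K) := by
          rw [Finset.sum_const, Finset.card_univ, Fintype.card_fin, nsmul_eq_mul]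
          field_simp
      _ = _ := Finset.sum_congr rfl fun k _ => congrArg (_ * ·) (hunit (r, k)).symm
  · simp only [κ, Fintype.card_prod, Fintype.card_fin]
    exact le_of_eq (by ring)

end RescaledLayers

/-! ### Minima over the relevant positions -/

section Minima

variable {T : ℕ} {S : Finset (Fin T)}

lemma iInf_mem_le (v : Fin T → ℝ) {t : Fin T} (ht : t ∈ S) : ⨅ t : {t // t ∈ S}, v t ≤ v t :=
  ciInf_le (Set.finite_range fun t : {t // t ∈ S} => v t).bddBelow ⟨t, ht⟩

lemma exists_eq_iInf_mem (v : Fin T → ℝ) (hS : S.Nonempty) :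
    ∃ t ∈ S, v t = ⨅ t : {t // t ∈ S}, v t := by
  have : Nonempty {t // t ∈ S} := hS.to_subtype
  obtain ⟨t, ht⟩ := exists_eq_ciInf_of_finite (f := fun t : {t // t ∈ S} => v t)
  exact ⟨t, t.2, ht⟩

lemma abs_iInf_mem_sub_le (v w : Fin T → ℝ) (hS : S.Nonempty) {c : ℝ}
    (h : ∀ t, |v t - w t| ≤ c) :
    |(⨅ t : {t // t ∈ S}, v t) - ⨅ t : {t // t ∈ S}, w t| ≤ c := by
  obtain ⟨t, ht, hvt⟩ := exists_eq_iInf_mem v hS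
  obtain ⟨u, hu, hwu⟩ := exists_eq_iInf_mem w hS
  have hut := abs_le.1 (h t)
  have huu := abs_le.1 (h u)
  rw [abs_le]
  constructor <;> linarith [iInf_mem_le v hu, iInf_mem_le w ht]

lemma mem_cube_iff {m : ℕ} {z : Fin m → ℝ} : z ∈ cube m ↔ ∀ i, z i ∈ Set.Icc (0 : ℝ) 1 :=
  ⟨fun h i => ⟨h.1 i, h.2 i⟩, fun h => ⟨fun i => (h i).1, fun i => (h i).2⟩⟩

end Minima

section Targets

variable {d T D : ℕ} {F₀ : (Fin D → ℝ) → ℝ} {f : Fin D → (Fin d → ℝ) → ℝ}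
  {S : Fin D → Finset (Fin T)} {X : Fin T → Fin d → ℝ}

lemma iInf_comp_mem_cube (hf : ∀ i, Set.MapsTo (f i) (cube d) (Set.Icc 0 1))
    (hS : ∀ i, (S i).Nonempty) (hX : X ∈ inputSpace d T) :
    (fun i => ⨅ t : {t // t ∈ S i}, f i (X t)) ∈ cube D := by
  refine mem_cube_iff.2 fun i => ?_
  obtain ⟨t, -, ht⟩ := exists_eq_iInf_mem (fun t => f i (X t)) (hS i)
  exact ht ▸ hf i (hX t)

lemma abs_sub_retrievalTarget_le {Λ : ℝ≥0} (hΛ : LipschitzOnWith Λ F₀ (cube D))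
    (hf : ∀ i, Set.MapsTo (f i) (cube d) (Set.Icc 0 1)) (hS : ∀ i, (S i).Nonempty)
    (hX : X ∈ inputSpace d T) {z : Fin D → ℝ} (hz : z ∈ cube D) {η : ℝ} (hη : 0 ≤ η)
    (hzη : ∀ i, |z i - ⨅ t : {t // t ∈ S i}, f i (X t)| ≤ η) {y δ : ℝ} (hy : |F₀ z - y| ≤ δ) :
    |y - retrievalTarget F₀ f S X| ≤ δ + Λ * η := by
  have hlip := hΛ.dist_le_mul z hz _ (iInf_comp_mem_cube hf hS hX)
  rw [abs_sub_comm] at hy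
  exact (abs_sub_le _ (F₀ z) _).trans
    (add_le_add hy (hlip.trans (mul_le_mul_of_nonneg_left ((dist_pi_le_iff hη).2 hzη) Λ.2)))

lemma IsRetrievalTask.nonempty {xmin : Fin D → Fin d → ℝ} (h : IsRetrievalTask F₀ f S xmin)
    (hT : 1 ≤ T) (i : Fin D) : (S i).Nonempty := by
  have hT0 : (0 : ℝ) < T := Nat.cast_pos.2 hT
  exact Finset.card_pos.1 (Nat.cast_pos.1
    (lt_of_lt_of_le (div_pos hT0 four_pos) (h.quarter_le_card i)))

end Targets

/-! ### From approximation rates of the components to the rate of the target -/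

section Rates

variable {d T D : ℕ} {𝒜 : Set (ℝ → ℝ)} {W : Set ℝ}

/-- Shallow networks approximating the components `F₀` and `fᵢ` of a target up to an error `δ`. -/
structure ComponentNets (𝒜 : Set (ℝ → ℝ)) (W : Set ℝ) (F₀ : (Fin D → ℝ) → ℝ)
    (f : Fin D → (Fin d → ℝ) → ℝ) (δ : ℝ) where
  outerAct : ℝ → ℝ
  outerAct_mem : outerAct ∈ 𝒜
  outerNet : ShallowNet (Fin D)
  outerNet_weightsIn : outerNet.WeightsIn unitWeights
  abs_sub_outerNet_le : ∀ z ∈ cube D, |F₀ z - outerNet.eval outerAct z| ≤ δ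
  act : Fin D → ℝ → ℝ
  act_mem : ∀ i, act i ∈ 𝒜
  net : Fin D → ShallowNet (Fin d)
  net_weightsIn : ∀ i, (net i).WeightsIn W
  abs_sub_net_le : ∀ i, ∀ x ∈ cube d, |f i x - (net i).eval (act i) x| ≤ δ

/-- The total width of the component networks; the summand `1` keeps it positive, so that it
dominates the number of parameters also when all widths vanish. -/
def ComponentNets.size {F₀ : (Fin D → ℝ) → ℝ} {f : Fin D → (Fin d → ℝ) → ℝ} {δ : ℝ}
    (N : ComponentNets 𝒜 W F₀ f δ) : ℕ :=
  N.outerNet.width + ∑ i, (N.net i).width + 1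

lemma div_rpow_le_of_le {C δ R γ g : ℝ} (hC : 0 ≤ C) (hδ : 0 < δ) (hδR : δ ≤ R) (hγ : γ ≤ g) :
    C / δ ^ γ ≤ C * R ^ (g - γ) / δ ^ g := by
  have hpow : δ ^ (g - γ) ≤ R ^ (g - γ) := Real.rpow_le_rpow hδ.le hδR (sub_nonneg.2 hγ)
  rw [div_le_div_iff₀ (by positivity) (by positivity)]
  calc C * δ ^ g = C * (δ ^ (g - γ) * δ ^ γ) := by rw [← Real.rpow_add hδ, sub_add_cancel]
    _ ≤ C * (R ^ (g - γ) * δ ^ γ) := by gcongr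
    _ = C * R ^ (g - γ) * δ ^ γ := by ring

lemma exists_componentNets {C₁ γ₁ C₂ γ₂ R : ℝ} (hC₁ : 0 < C₁) (hγ₁ : 0 < γ₁) (hC₂ : 0 < C₂)
    (hR : 0 < R) :
    ∃ K : ℝ, 0 < K ∧ ∀ (F₀ : (Fin D → ℝ) → ℝ) (f : Fin D → (Fin d → ℝ) → ℝ),
      ApproxAtRate 𝒜 unitWeights C₁ γ₁ F₀ → (∀ i, ApproxAtRate 𝒜 W C₂ γ₂ (f i)) →
      ∀ δ, 0 < δ → δ ≤ R → ∃ N : ComponentNets 𝒜 W F₀ f δ, (N.size : ℝ) ≤ K / δ ^ max γ₁ γ₂ := by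
  set g := max γ₁ γ₂
  refine ⟨C₁ * R ^ (g - γ₁) + D * (C₂ * R ^ (g - γ₂)) + 1 * R ^ (g - 0), by positivity,
    fun F₀ f hF₀ hf δ hδ hδR => ?_⟩
  obtain ⟨σ₀, hσ₀, N₀, hN₀, hwidth₀, happrox₀⟩ := hF₀.exists_shallowNet hδ
  choose σ hσ N hN hwidth happrox using fun i => (hf i).exists_shallowNet hδ
  refine ⟨⟨σ₀, hσ₀, N₀, hN₀, happrox₀, σ, hσ, N, hN, happrox⟩, ?_⟩
  have houter := hwidth₀.trans (div_rpow_le_of_le hC₁.le hδ hδR (le_max_left γ₁ γ₂))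
  have hinner : ∑ i, ((N i).width : ℝ) ≤ ∑ _i : Fin D, C₂ * R ^ (g - γ₂) / δ ^ g :=
    Finset.sum_le_sum fun i _ =>
      (hwidth i).trans (div_rpow_le_of_le hC₂.le hδ hδR (le_max_right γ₁ γ₂))
  have hone : 1 ≤ 1 * R ^ (g - 0) / δ ^ g := by
    simpa using div_rpow_le_of_le zero_le_one hδ hδR (hγ₁.le.trans (le_max_left γ₁ γ₂))
  rw [Finset.sum_const, Finset.card_univ, Fintype.card_fin, nsmul_eq_mul] at hinner
  simp only [ComponentNets.size]
  push_cast
  rw [add_div, add_div, mul_div_assoc (D : ℝ)]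
  exact add_le_add (add_le_add houter hinner) hone

lemma ApproxAtRate.abs_le {C γ : ℝ} (hC : 0 < C) (hγ : 0 < γ) {m : ℕ} {g : (Fin m → ℝ) → ℝ}
    (h : ApproxAtRate 𝒜 unitWeights C γ g) {x : Fin m → ℝ} (hx : x ∈ cube m) :
    |g x| ≤ 1 + (C + 1) ^ (1 / γ) := by
  -- At this accuracy the approximating network has no hidden units, hence is constant.
  have hδ : 0 < (C + 1) ^ (1 / γ) := by positivity
  obtain ⟨σ, -, N, hN, hwidth, happrox⟩ := h.exists_shallowNet hδ
  have hwidth' : (N.width : ℝ) < 1 := by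
    refine hwidth.trans_lt ?_
    rw [← Real.rpow_mul (by positivity), one_div_mul_cancel hγ.ne', Real.rpow_one,
      div_lt_one (by positivity)]
    exact lt_add_one C
  have hempty : IsEmpty (Fin N.width) := by
    rw [← Fintype.card_eq_zero_iff, Fintype.card_fin]
    exact Nat.lt_one_iff.1 (by exact_mod_cast hwidth')
  have heval : N.eval σ x = N.const := by simp [ShallowNet.eval]
  have hclose := happrox x hx
  rw [heval] at hclose
  linarith [abs_sub_abs_le_abs_sub (g x) N.const, abs_le_one_of_mem_unitWeights hN.const_mem]

lemma hypothesisClass_mono {ℓ L h n d T M M' : ℕ} (hM : M ≤ M') :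
    hypothesisClass 𝒜 ℓ L h n d T M ⊆ hypothesisClass 𝒜 ℓ L h n d T M' := by
  rintro H ⟨σ, hσ, τ, hτ, P, a, G, hnorm, ha, hW, hcount, hH⟩
  exact ⟨σ, hσ, τ, hτ, P, a, G, hnorm, ha, hW, hcount.trans hM, hH⟩

lemma epsApproximates_of_lt (h𝒜 : 𝒜.Nonempty) {𝒜' : Set (ℝ → ℝ)} (hT : 1 ≤ T)
    {C₁ γ₁ C₂ γ₂ : ℝ} {Λ : ℝ≥0} (hC₁ : 0 < C₁) (hγ₁ : 0 < γ₁) {ε : ℝ}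
    (hε : 1 + (C₁ + 1) ^ (1 / γ₁) < ε) (ℓ L h n M : ℕ) :
    EpsApproximates (hypothesisClass 𝒜 (ℓ + 1) (L + 1) h n d T M) ε
      (approxTargetClass 𝒜' W d T D C₁ γ₁ C₂ γ₂ Λ) := by
  rintro F ⟨F₀, f, S, xmin, htask, -, happrox, -, rfl⟩
  refine ⟨_, zero_mem_hypothesisClass h𝒜 ℓ L h n d T M, _, hε, fun X hX => ?_⟩
  rw [zero_sub, abs_neg]
  exact happrox.abs_le hC₁ hγ₁ (iInf_comp_mem_cube htask.mapsTo_comp (htask.nonempty hT) hX)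

/-- Networks approximating the components of a target up to an error `δ ≤ R` can be assembled into a
transformer of the class `ℋ` that approximates the target up to a multiple of `δ`, at the expense of
a factor `B / δ ^ θ` in the number of parameters. -/
def Assembles (𝒜 : Set (ℝ → ℝ)) (W : Set ℝ) (ℋ : ℕ → Set ((Fin T → Fin d → ℝ) → ℝ)) (D : ℕ)
    (R B : ℝ) (θ : ℕ) : Prop :=
  ∀ ⦃F₀ : (Fin D → ℝ) → ℝ⦄ ⦃f : Fin D → (Fin d → ℝ) → ℝ⦄ ⦃S : Fin D → Finset (Fin T)⦄ ⦃Λ : ℝ≥0⦄,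
    LipschitzOnWith Λ F₀ (cube D) → (∀ i, Set.MapsTo (f i) (cube d) (Set.Icc 0 1)) →
    (∀ i, (S i).Nonempty) → ∀ ⦃δ⦄, 0 < δ → δ ≤ R → ∀ N : ComponentNets 𝒜 W F₀ f δ,
    ∃ M : ℕ, (M : ℝ) ≤ B * N.size / δ ^ θ ∧ ∃ H ∈ ℋ M, ∀ X ∈ inputSpace d T,
      |H X - retrievalTarget F₀ f S X| ≤ δ + Λ * (3 * δ)

lemma exists_rate_of_assembles {C₁ γ₁ C₂ γ₂ B : ℝ} {Λ : ℝ≥0} {θ : ℕ} (hT : 1 ≤ T) (hC₁ : 0 < C₁)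
    (hγ₁ : 0 < γ₁) (hC₂ : 0 < C₂) (hB : 0 < B) (h𝒜 : 𝒜.Nonempty) :
    ∃ C : ℝ, 0 < C ∧ ∀ L h n : ℕ,
      Assembles 𝒜 W (hypothesisClass 𝒜 2 (L + 1) h n d T) D (1 + (C₁ + 1) ^ (1 / γ₁)) B θ →
      ∀ ε : ℝ, 0 < ε → ∀ M : ℕ, C / ε ^ (θ + max γ₁ γ₂) < M →
        EpsApproximates (hypothesisClass 𝒜 2 (L + 1) h n d T M) ε
          (approxTargetClass 𝒜 W d T D C₁ γ₁ C₂ γ₂ Λ) := by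
  set R := 1 + (C₁ + 1) ^ (1 / γ₁)
  have hR : 0 < R := by positivity
  set k : ℝ := 2 * (1 + 3 * Λ) with hk
  have hk1 : 1 ≤ k := by linarith [Λ.2]
  obtain ⟨K, hK, hnets⟩ :=
    exists_componentNets (𝒜 := 𝒜) (W := W) (d := d) (D := D) (γ₂ := γ₂) hC₁ hγ₁ hC₂ hR
  refine ⟨B * K * k ^ (θ + max γ₁ γ₂), by positivity, fun L h n hℋ ε hε M hM => ?_⟩
  rcases lt_or_ge R ε with hRε | hεR
  · exact epsApproximates_of_lt h𝒜 hT hC₁ hγ₁ hRε 1 L h n M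
  rintro F ⟨F₀, f, S, xmin, htask, hΛ, hF₀, hf, rfl⟩
  set δ := ε / k with hδ
  have hδ0 : 0 < δ := by positivity
  have hδR : δ ≤ R := (div_le_self hε.le hk1).trans hεR
  obtain ⟨N, hN⟩ := hnets F₀ f hF₀ hf δ hδ0 hδR
  obtain ⟨M', hM', H, hH, happrox⟩ :=
    hℋ hΛ htask.mapsTo_comp (htask.nonempty hT) hδ0 hδR N
  have hcount : (M' : ℝ) ≤ M := by
    calc (M' : ℝ) ≤ B * (K / δ ^ max γ₁ γ₂) / δ ^ θ := hM'.trans (by gcongr)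
      _ = B * K * k ^ (θ + max γ₁ γ₂) / ε ^ (θ + max γ₁ γ₂) := by
          rw [← mul_div_assoc, div_div, ← Real.rpow_natCast, ← Real.rpow_add hδ0, hδ,
            Real.div_rpow hε.le (by positivity), div_div_eq_mul_div, add_comm (max γ₁ γ₂)]
      _ ≤ M := hM.le
  refine ⟨H, hypothesisClass_mono (by exact_mod_cast hcount) hH, ε / 2, half_lt_self hε,
    fun X hX => (happrox X hX).trans_eq ?_⟩
  rw [hδ, hk]
  field_simp

end Rates

/-! ### Softmax averages -/

section Softmax

variable {T : ℕ} {β : ℝ}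

lemma softmax_nonneg (ρ : Fin T → ℝ) (t : Fin T) : 0 ≤ softmax β ρ t := by
  unfold softmax
  positivity

lemma sum_softmax (hT : 1 ≤ T) (ρ : Fin T → ℝ) : ∑ t, softmax β ρ t = 1 := by
  have : Nonempty (Fin T) := ⟨⟨0, hT⟩⟩
  simp only [softmax]
  rw [← Finset.sum_div, div_self]
  exact (Finset.sum_pos (fun t _ => Real.exp_pos _) Finset.univ_nonempty).ne'

lemma softmax_mul (β lam : ℝ) (ρ : Fin T → ℝ) (t : Fin T) :
    softmax β (fun t => lam * ρ t) t = softmax (β * lam) ρ t := by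
  simp only [softmax, mul_assoc]

lemma sum_softmax_mul_mem_Icc (hT : 1 ≤ T) (ρ : Fin T → ℝ) {v : Fin T → ℝ}
    (hv : ∀ t, v t ∈ Set.Icc (0 : ℝ) 1) : ∑ t, softmax β ρ t * v t ∈ Set.Icc (0 : ℝ) 1 := by
  refine ⟨Finset.sum_nonneg fun t _ => mul_nonneg (softmax_nonneg _ _) (hv t).1, ?_⟩
  rw [← sum_softmax (β := β) hT ρ]
  exact Finset.sum_le_sum fun t _ => mul_le_of_le_one_right (softmax_nonneg _ _) (hv t).2

lemma softmax_le_exp_sub (ρ : Fin T → ℝ) (t t₀ : Fin T) :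
    softmax β ρ t ≤ Real.exp (β * ρ t - β * ρ t₀) := by
  rw [softmax, Real.exp_sub]
  gcongr
  exact Finset.single_le_sum (f := fun t => Real.exp (β * ρ t)) (fun t _ => (Real.exp_pos _).le)
    (Finset.mem_univ t₀)

lemma softmax_neg_mul_sub_le (hβ : 0 < β) (g : Fin T → ℝ) {t t₀ : Fin T} (h : g t₀ ≤ g t) :
    softmax β (-g) t * (g t - g t₀) ≤ 1 / β := by
  have hgap : 0 ≤ g t - g t₀ := sub_nonneg.2 h
  have hexp : softmax β (-g) t ≤ (Real.exp (β * (g t - g t₀)))⁻¹ := by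
    refine (softmax_le_exp_sub _ t t₀).trans_eq ?_
    rw [← Real.exp_neg, Pi.neg_apply, Pi.neg_apply]
    ring_nf
  calc softmax β (-g) t * (g t - g t₀)
      ≤ (Real.exp (β * (g t - g t₀)))⁻¹ * (Real.exp (β * (g t - g t₀)) / β) := by
        refine mul_le_mul hexp ?_ hgap (by positivity)
        rw [le_div_iff₀ hβ, mul_comm]
        linarith [Real.add_one_le_exp (β * (g t - g t₀))]
    _ = 1 / β := by field_simp

lemma abs_sum_softmax_neg_mul_sub_le (hβ : 0 < β) (g v : Fin T → ℝ) (t₀ : Fin T)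
    (h : ∀ t, |v t - v t₀| ≤ g t - g t₀) :
    |∑ t, softmax β (-g) t * v t - v t₀| ≤ T / β := by
  have hT : 1 ≤ T := Nat.one_le_of_lt t₀.2
  calc |∑ t, softmax β (-g) t * v t - v t₀| = |∑ t, softmax β (-g) t * (v t - v t₀)| := by
        simp only [mul_sub, Finset.sum_sub_distrib, ← Finset.sum_mul, sum_softmax hT, one_mul]
    _ ≤ ∑ t, |softmax β (-g) t * (v t - v t₀)| := Finset.abs_sum_le_sum_abs _ _
    _ ≤ ∑ _t : Fin T, 1 / β := by
        refine Finset.sum_le_sum fun t _ => ?_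
        rw [abs_mul, abs_of_nonneg (softmax_nonneg _ _)]
        exact (mul_le_mul_of_nonneg_left (h t) (softmax_nonneg _ _)).trans
          (softmax_neg_mul_sub_le hβ g (sub_nonneg.1 ((abs_nonneg _).trans (h t))))
    _ = T / β := by simp [div_eq_mul_inv]

/-- The penalty added to the score of a position outside of `S`; it exceeds all differences of
values in `[0, 1]`. -/
def penalty (S : Finset (Fin T)) (t : Fin T) : ℝ := if t ∈ S then 0 else 2

lemma abs_softmin_sub_iInf_le (hβ : 0 < β) {v : Fin T → ℝ} (hv : ∀ t, v t ∈ Set.Icc (0 : ℝ) 1)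
    {S : Finset (Fin T)} (hS : S.Nonempty) :
    |∑ t, softmax β (-(v + penalty S)) t * v t - ⨅ t : {t // t ∈ S}, v t| ≤ T / β := by
  obtain ⟨t₀, ht₀, hmin⟩ := exists_eq_iInf_mem v hS
  rw [← hmin]
  refine abs_sum_softmax_neg_mul_sub_le hβ _ v t₀ fun t => ?_
  simp only [Pi.add_apply, penalty, ht₀, if_true]
  split_ifs with ht
  · rw [abs_of_nonneg (by linarith [iInf_mem_le v ht])]
    simp
  · rw [abs_le]
    constructor <;> linarith [(hv t).1, (hv t).2, (hv t₀).1, (hv t₀).2]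

lemma abs_softmin_sub_iInf_le_add (hβ : 0 < β) {v w : Fin T → ℝ} {η : ℝ}
    (hv : ∀ t, v t ∈ Set.Icc (0 : ℝ) 1) (hvw : ∀ t, |v t - w t| ≤ η) {S : Finset (Fin T)}
    (hS : S.Nonempty) :
    |∑ t, softmax β (-(v + penalty S)) t * v t - ⨅ t : {t // t ∈ S}, w t| ≤ T / β + η :=
  (abs_sub_le _ _ _).trans
    (add_le_add (abs_softmin_sub_iInf_le hβ hv hS) (abs_iInf_mem_sub_le v w hS hvw))

end Softmax

/-! ### `D` heads of dimension two -/

section MultiHead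

/-- The attention layer in which head `i` reads the two coordinates of block `i`, uses minus their
sum as score, and returns the first one. -/
def minAttention (D : ℕ) (β : ℝ) : Attention D 2 where
  WQ i r q := if r = 0 ∧ q = finProdFinEquiv (i, 1) then 1 else 0
  WK i r q := if r = 0 ∧ (finProdFinEquiv.symm q).1 = i then -1 else 0
  WV i r q := if r = 0 ∧ q = finProdFinEquiv (i, 0) then 1 else 0
  WO := 1
  c₀ q := if (finProdFinEquiv.symm q).2 = 1 then 1 else 0
  β := β

lemma minAttention_admissible (D : ℕ) {β : ℝ} (hβ : 0 < β) : (minAttention D β).Admissible := by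
  refine ⟨hβ, fun i r j => ?_, fun i r j => ?_, fun i r j => ?_, fun r j => ?_⟩ <;>
    simp only [minAttention, Matrix.one_apply] <;> split_ifs <;> simp

variable {d T D : ℕ}

lemma minAttention_query (β : ℝ) (i : Fin D) :
    (minAttention D β).WQ i *ᵥ (minAttention D β).c₀ = Pi.single 0 1 := by
  ext r
  have hread : (∑ q : Fin (D * 2), if (finProdFinEquiv.symm q).2 = 1 then
      (if q = finProdFinEquiv (i, 1) then (1 : ℝ) else 0) else 0) = 1 := by
    rw [← finProdFinEquiv.sum_comp, Finset.sum_eq_single (i, 1) (by simp_all) (by simp)]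
    simp only [Equiv.symm_apply_apply, if_true]
  by_cases hr : r = 0
  · simpa [minAttention, Matrix.mulVec, dotProduct, hr] using hread
  · simp [minAttention, Matrix.mulVec, dotProduct, hr]

lemma minAttention_key (β : ℝ) (i : Fin D) (x : Fin (D * 2) → ℝ) :
    ((minAttention D β).WK i *ᵥ x) 0 =
      -(x (finProdFinEquiv (i, 0)) + x (finProdFinEquiv (i, 1))) := by
  simp only [minAttention, Matrix.mulVec, dotProduct, true_and]
  rw [← finProdFinEquiv.sum_comp, Fintype.sum_prod_type]
  simp only [Equiv.symm_apply_apply, ite_mul, zero_mul, Finset.sum_ite_irrel,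
    Finset.sum_ite_eq', Finset.mem_univ, if_true, Fin.sum_univ_two, Finset.sum_const_zero]
  ring

lemma minAttention_value (β : ℝ) (i : Fin D) (x : Fin (D * 2) → ℝ) :
    ((minAttention D β).WV i *ᵥ x) 0 = x (finProdFinEquiv (i, 0)) := by
  simp [minAttention, Matrix.mulVec, dotProduct]

lemma minAttention_out (β : ℝ) (e : Fin T → Fin (D * 2) → ℝ) (i : Fin D) :
    (minAttention D β).out e (finProdFinEquiv (i, 0)) =
      ∑ t, softmax β
          (fun t' => -(e t' (finProdFinEquiv (i, 0)) + e t' (finProdFinEquiv (i, 1)))) t *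
        e t (finProdFinEquiv (i, 0)) := by
  have hout : (minAttention D β).out e (finProdFinEquiv (i, 0)) =
      (minAttention D β).head e i 0 := by
    have htoken : (minAttention D β).c₀ (finProdFinEquiv (i, 0)) = 0 := by
      simp only [minAttention, Equiv.symm_apply_apply, zero_ne_one, if_false]
    have hproj : (minAttention D β).WO = 1 := rfl
    rw [Attention.out, Pi.add_apply, htoken, zero_add, hproj, Matrix.one_mulVec,
      Attention.concatHeads, Equiv.symm_apply_apply]
  simp only [hout, Attention.head, minAttention_query, single_dotProduct, minAttention_key, one_mul,
    Finset.sum_apply, Pi.smul_apply, minAttention_value, smul_eq_mul]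
  rfl

lemma smul_minAttention_out {K β : ℝ} (hK : K ≠ 0) {e : Fin T → Fin (D * 2) → ℝ} {i : Fin D}
    {v w : Fin T → ℝ} (hv : ∀ t, e t (finProdFinEquiv (i, 0)) = v t / K)
    (hw : ∀ t, e t (finProdFinEquiv (i, 1)) = w t / K) :
    K * (minAttention D (K * β)).out e (finProdFinEquiv (i, 0)) =
      ∑ t, softmax β (-(v + w)) t * v t := by
  have hscore : (fun t => -(v t / K + w t / K)) = fun t => K⁻¹ * (-(v + w)) t := by
    ext t
    simp only [Pi.neg_apply, Pi.add_apply]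
    ring
  simp only [minAttention_out, hv, hw, hscore, softmax_mul, Finset.mul_sum]
  rw [mul_comm K β, mul_inv_cancel_right₀ hK]
  refine Finset.sum_congr rfl fun t _ => ?_
  field_simp

/-- The shallow network on tokens and one-hot positions that computes a multiple of the penalty with
the identity as activation. -/
def penaltyNet (d : ℕ) (S : Finset (Fin T)) (k : ℝ) : ShallowNet (Fin d ⊕ Fin T) where
  width := 1
  inner := Matrix.of fun _ => Sum.elim 0 (penalty S)
  bias := 0
  outer := fun _ => k
  const := 0

lemma penaltyNet_eval (S : Finset (Fin T)) (k : ℝ) (x : Fin d → ℝ) (t : Fin T) :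
    (penaltyNet d S k).eval id (Sum.elim x (Pi.single t 1)) = k * penalty S t := by
  change (∑ _r : Fin 1, k * ((∑ j, Sum.elim (0 : Fin d → ℝ) (penalty S) j *
    Sum.elim x (Pi.single t (1 : ℝ)) j) + 0)) + 0 = _
  simp [Pi.single_apply]

lemma abs_sumElim_single_le_one {x : Fin d → ℝ} (hx : x ∈ cube d) (t : Fin T) (j : Fin d ⊕ Fin T) :
    |Sum.elim x (Pi.single t 1) j| ≤ 1 := by
  rcases j with j | t'
  · rw [Sum.elim_inl, abs_of_nonneg (hx.1 j)]
    exact hx.2 j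
  · rw [Sum.elim_inr, Pi.single_apply]
    split_ifs <;> simp

lemma exists_minEncoder {σ : Fin D → ℝ → ℝ} (hσ : ∀ i, LipschitzWith 1 (σ i))
    (N : Fin D → ShallowNet (Fin d)) (S : Fin D → Finset (Fin T)) (K : ℝ) :
    ∃ (τ : ℝ → ℝ) (P : FFN (D * 2) 2 (d + T)), LipschitzWith 1 τ ∧
      P.paramCount ≤ ((∑ i, (N i).width) + D) * (d + T + 1 + D * 2) + D * 2 ∧
      ∀ x ∈ cube d, ∀ (t : Fin T) (i : Fin D),
        encode τ P x t (finProdFinEquiv (i, 0)) = (N i).eval (σ i) x / K ∧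
        encode τ P x t (finProdFinEquiv (i, 1)) = penalty (S i) t / K := by
  obtain ⟨τ, g, hτ, hg, heval⟩ := exists_realizes_shallowNets (o := Fin D × Fin 2)
    (fun q => ![((N q.1).affine K⁻¹ 0).ignoreRight (Fin T), penaltyNet d (S q.1) K⁻¹] q.2)
    (fun q => ![σ q.1, id] q.2) (by
      rintro ⟨i, r⟩
      fin_cases r
      exacts [hσ i, LipschitzWith.id])
  obtain ⟨P, hP, hencode⟩ := hg.exists_encoder finProdFinEquiv
  refine ⟨τ, P, hτ, hP.trans_eq ?_, fun x hx t i => ?_⟩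
  · have hwidth : ∀ i, (((N i).affine K⁻¹ 0).ignoreRight (Fin T)).width = (N i).width :=
      fun _ => rfl
    simp [Fintype.sum_prod_type, Finset.sum_add_distrib, hwidth, penaltyNet]
  · have hunit := heval _ (abs_sumElim_single_le_one hx t)
    rw [hencode, hencode, hunit, hunit]
    constructor
    · simp [ShallowNet.eval_ignoreRight, ShallowNet.eval_affine, div_eq_inv_mul]
    · simp [penaltyNet_eval, div_eq_inv_mul]

lemma exists_normalized {m : ℕ} {s : Set (Fin m → ℝ)} {f : (Fin m → ℝ) → ℝ} {σ : ℝ → ℝ}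
    {N : ShallowNet (Fin m)} {δ : ℝ} (hδ : 0 < δ) (hf : Set.MapsTo f s (Set.Icc 0 1))
    (h : ∀ x ∈ s, |f x - N.eval σ x| ≤ δ) :
    ∃ N' : ShallowNet (Fin m), N'.width = N.width ∧
      ∀ x ∈ s, N'.eval σ x ∈ Set.Icc (0 : ℝ) 1 ∧ |N'.eval σ x - f x| ≤ 2 * δ := by
  have hδ' : 0 < 1 + 2 * δ := by linarith
  refine ⟨N.affine (1 / (1 + 2 * δ)) (δ / (1 + 2 * δ)), rfl, fun x hx => ?_⟩
  have happrox := abs_le.1 (h x hx)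
  obtain ⟨hf0, hf1⟩ := hf hx
  have heval : (N.affine (1 / (1 + 2 * δ)) (δ / (1 + 2 * δ))).eval σ x =
      (N.eval σ x + δ) / (1 + 2 * δ) := by
    rw [ShallowNet.eval_affine]
    ring
  rw [heval]
  refine ⟨⟨div_nonneg (by linarith) hδ'.le, (div_le_one hδ').2 (by linarith)⟩, ?_⟩
  rw [div_sub' hδ'.ne', abs_div, abs_of_pos hδ', div_le_iff₀ hδ', abs_le]
  constructor <;> nlinarith

lemma sqrt_sum_sq_encoding_le_one (hD : 1 ≤ D) {e : Fin (D * 2) → ℝ} {v : Fin D → ℝ}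
    (hv : ∀ i, v i ∈ Set.Icc (0 : ℝ) 1) {S : Fin D → Finset (Fin T)} {t : Fin T}
    (he : ∀ i, e (finProdFinEquiv (i, 0)) = v i / (3 * D : ℕ) ∧
      e (finProdFinEquiv (i, 1)) = penalty (S i) t / (3 * D : ℕ)) :
    √(∑ q, e q ^ 2) ≤ 1 := by
  have hD1 : (1 : ℝ) ≤ D := Nat.one_le_cast.2 hD
  have hblock : ∀ i, ∑ r, e (finProdFinEquiv (i, r)) ^ 2 ≤ 5 / (3 * D : ℕ) ^ 2 := by
    intro i
    have hpenalty : penalty (S i) t ^ 2 ≤ 4 := by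
      rw [penalty]
      split_ifs <;> norm_num
    rw [Fin.sum_univ_two, (he i).1, (he i).2, div_pow, div_pow, ← add_div]
    gcongr
    linarith [pow_le_one₀ (n := 2) (hv i).1 (hv i).2]
  rw [Real.sqrt_le_left zero_le_one, one_pow, ← finProdFinEquiv.sum_comp, Fintype.sum_prod_type]
  refine (Finset.sum_le_sum fun i _ => hblock i).trans ?_
  rw [Finset.sum_const, Finset.card_univ, Fintype.card_fin, nsmul_eq_mul, ← mul_div_assoc,
    div_le_one (by positivity)]
  push_cast
  nlinarith

-- Head `i` approximates the minimum of `fᵢ` over `Sᵢ` by a softmin. The embedding is contracted by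
-- `3 D` to meet the norm constraint, and the feed-forward block undoes the contraction.
lemma exists_multihead_approximation (hT : 1 ≤ T) (hD : 1 ≤ D) {F₀ : (Fin D → ℝ) → ℝ}
    {f : Fin D → (Fin d → ℝ) → ℝ} {S : Fin D → Finset (Fin T)} {Λ : ℝ≥0}
    (hΛ : LipschitzOnWith Λ F₀ (cube D)) (hf : ∀ i, Set.MapsTo (f i) (cube d) (Set.Icc 0 1))
    (hS : ∀ i, (S i).Nonempty) {δ : ℝ} (hδ : 0 < δ)
    (N : ComponentNets lipschitzActivations Set.univ F₀ f δ) :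
    ∃ H ∈ hypothesisClass lipschitzActivations 2 2 D 2 d T
      (((∑ i, (N.net i).width) + D) * (d + T + 1 + D * 2) + D * 2 +
        (N.outerNet.width * (3 * D) * (D * 2 + 2) + 1)),
      ∀ X ∈ inputSpace d T, |H X - retrievalTarget F₀ f S X| ≤ δ + Λ * (3 * δ) := by
  have hK : 1 ≤ 3 * D := by omega
  have hK0 : (0 : ℝ) < (3 * D : ℕ) := by positivity
  have hβ : 0 < T / δ := by positivity
  choose g hwidth hg using fun i => exists_normalized hδ (hf i) (N.abs_sub_net_le i)
  obtain ⟨τ, P, hτ, hP, hencode⟩ := exists_minEncoder N.act_mem g S (3 * D : ℕ)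
  obtain ⟨G, hGW, hG, hGeval⟩ := (N.outerNet.readAt (0 : Fin 2)).realizes_smul
    (N.outerNet_weightsIn.readAt zero_mem_unitWeights 0) hK N.outerAct
    finProdFinEquiv (Equiv.refl (Fin 1))
  have hcount : P.paramCount + G.paramCount ≤ _ := add_le_add
    (by simpa only [hwidth] using hP)
    (hG.trans_eq (by rw [Fintype.card_prod, Fintype.card_fin, Fintype.card_fin]))
  refine ⟨_, ⟨τ, hτ, rescale (3 * D : ℕ) N.outerAct, lipschitzWith_rescale N.outerAct_mem hK0, P,
    minAttention D ((3 * D : ℕ) * (T / δ)), G, fun x hx t =>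
      sqrt_sum_sq_encoding_le_one hD (fun i => (hg i x hx).1) (hencode x hx t),
    minAttention_admissible D (by positivity), hGW, hcount, rfl⟩, fun X hX => ?_⟩
  set z : Fin D → ℝ := fun i => ∑ t, softmax (T / δ)
    (-((fun t => (g i).eval (N.act i) (X t)) + penalty (S i))) t * (g i).eval (N.act i) (X t)
  have hout : ∀ i, ((3 * D : ℕ) : ℝ) * (minAttention D ((3 * D : ℕ) * (T / δ))).out
      (fun t => encode τ P (X t) t) (finProdFinEquiv (i, 0)) = z i := fun i =>
    smul_minAttention_out hK0.ne' (fun t => (hencode _ (hX t) t i).1)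
      (fun t => (hencode _ (hX t) t i).2)
  have hblock : G.eval (rescale (3 * D : ℕ) N.outerAct)
      ((minAttention D ((3 * D : ℕ) * (T / δ))).out fun t => encode τ P (X t) t) 0 =
        N.outerNet.eval N.outerAct z := by
    rw [← funext hout]
    exact (hGeval _ 0).trans (ShallowNet.eval_readAt _ _ _)
  have hzmin : ∀ i, |z i - ⨅ t : {t // t ∈ S i}, f i (X t)| ≤ 3 * δ := fun i =>
    (abs_softmin_sub_iInf_le_add hβ (fun t => (hg i _ (hX t)).1) (fun t => (hg i _ (hX t)).2)
      (hS i)).trans_eq (by rw [div_div_cancel₀ (by positivity)]; ring)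
  have hzcube : z ∈ cube D :=
    mem_cube_iff.2 fun i => sum_softmax_mul_mem_Icc hT _ fun t => (hg i _ (hX t)).1
  simp only [hblock]
  exact abs_sub_retrievalTarget_le hΛ hf hS hX hzcube (by positivity) hzmin
    (N.abs_sub_outerNet_le z hzcube)

lemma assembles_multihead (hT : 1 ≤ T) (hD : 1 ≤ D) (R : ℝ) :
    Assembles lipschitzActivations Set.univ (hypothesisClass lipschitzActivations 2 2 D 2 d T) D R
      (3 * D * (d + T + 1 + D * 2) : ℕ) 0 := by
  intro F₀ f S Λ hΛ hf hS δ hδ _ N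
  refine ⟨_, ?_, exists_multihead_approximation hT hD hΛ hf hS hδ N⟩
  rw [pow_zero, div_one]
  norm_cast
  set p := ∑ i, (N.net i).width
  set p₀ := N.outerNet.width
  set q := d + T + 1 + D * 2
  calc (p + D) * q + D * 2 + (p₀ * (3 * D) * (D * 2 + 2) + 1)
      ≤ (D * p + D) * q + D * q + (p₀ * (3 * D) * q + D * q) := by
        gcongr
        · exact Nat.le_mul_of_pos_left p hD
        · omega
        · omega
        · exact Nat.mul_pos hD (by omega)
    _ ≤ 3 * D * q * (p₀ + p + 1) := Nat.le.intro (k := 2 * (D * p * q)) (by ring)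

theorem multihead_upper_bound (hT : 1 ≤ T) (hD : 1 ≤ D) {C₁ γ₁ C₂ : ℝ} (γ₂ : ℝ) (Λ : ℝ≥0)
    (hC₁ : 0 < C₁) (hγ₁ : 0 < γ₁) (hC₂ : 0 < C₂) :
    ∃ C : ℝ, 0 < C ∧ ∀ ε : ℝ, 0 < ε → ∀ M : ℕ, C / ε ^ max γ₁ γ₂ < M →
      EpsApproximates (hypothesisClass lipschitzActivations 2 2 D 2 d T M) ε
        (approxTargetClass lipschitzActivations Set.univ d T D C₁ γ₁ C₂ γ₂ Λ) := by
  obtain ⟨C, hC, hrate⟩ := exists_rate_of_assembles (𝒜 := lipschitzActivations) (W := Set.univ)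
    (d := d) (D := D) (γ₂ := γ₂) (B := (3 * D * (d + T + 1 + D * 2) : ℕ)) (Λ := Λ) (θ := 0) hT hC₁
    hγ₁ hC₂ (by positivity) ⟨id, LipschitzWith.id⟩
  simp only [Nat.cast_zero, zero_add] at hrate
  exact ⟨C, hC, hrate 1 D 2 (assembles_multihead hT hD _)⟩

end MultiHead

/-! ### Minima by ReLU layers -/

section ReluMin

lemma relu_nonneg (u : ℝ) : 0 ≤ relu u := le_max_right _ _

lemma rescale_relu {K : ℝ} (hK : 0 < K) : rescale K relu = relu := by
  ext u
  rw [rescale, relu, relu, div_eq_iff hK.ne', mul_comm _ K, mul_max_of_nonneg _ _ hK.le, mul_zero]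

variable {T : ℕ}

/-- The minimum over `S` of a function `φ` with values in `[0, 1]`, computed with precision `1 / N`
by two ReLU layers: the `k`-th summand is `1 / N` if the minimum is at least `(k + 1) / N`, and `0`
if it is at most `k / N`. -/
def reluMin (N : ℕ) (S : Finset (Fin T)) (φ : Fin T → ℝ) : ℝ :=
  ∑ k : Fin N, relu (1 / N - ∑ t ∈ S, relu (((k : ℕ) + 1) / N - φ t))

lemma reluMin_mem_Icc (N : ℕ) (S : Finset (Fin T)) (φ : Fin T → ℝ) :
    reluMin N S φ ∈ Set.Icc (0 : ℝ) 1 := by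
  refine ⟨Finset.sum_nonneg fun _ _ => relu_nonneg _, ?_⟩
  calc reluMin N S φ ≤ ∑ k : Fin N, (1 / N : ℝ) := by
        refine Finset.sum_le_sum fun k _ => max_le ?_ (by positivity)
        linarith [Finset.sum_nonneg fun t (_ : t ∈ S) => relu_nonneg (((k : ℕ) + 1) / N - φ t)]
    _ ≤ 1 := by
        rw [Finset.sum_const, Finset.card_univ, Fintype.card_fin, nsmul_eq_mul, mul_one_div]
        exact div_self_le_one _

variable {N : ℕ} {S : Finset (Fin T)}

lemma reluMin_le (hN : 1 ≤ N) (φ : Fin T → ℝ) {t : Fin T} (ht : t ∈ S) :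
    reluMin N S φ ≤ min (φ t) 1 - min (φ t) 0 := by
  have hN0 : (N : ℝ) ≠ 0 := by positivity
  have htelescope := Finset.sum_range_sub (fun k : ℕ => min (φ t) ((k : ℝ) / N)) N
  rw [div_self hN0, Nat.cast_zero, zero_div] at htelescope
  rw [← htelescope, ← Fin.sum_univ_eq_sum_range
    (fun k : ℕ => min (φ t) (((k + 1 : ℕ) : ℝ) / N) - min (φ t) ((k : ℝ) / N))]
  refine Finset.sum_le_sum fun k _ => ?_
  have hterm : relu (((k : ℕ) + 1) / N - φ t) ≤ ∑ t ∈ S, relu (((k : ℕ) + 1) / N - φ t) :=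
    Finset.single_le_sum (f := fun t => relu (((k : ℕ) + 1) / N - φ t))
      (fun t _ => relu_nonneg _) ht
  have hstep : ((k : ℕ) + 1 : ℝ) / N = (k : ℕ) / N + 1 / N := add_div _ _ _
  have hpos : (0 : ℝ) ≤ 1 / N := by positivity
  rw [relu] at hterm ⊢
  push_cast
  grind

lemma le_reluMin (hN : 1 ≤ N) {φ : Fin T → ℝ} {m : ℝ} (hm : ∀ t ∈ S, m ≤ φ t) :
    min m (1 + 1 / N) - 1 / N ≤ reluMin N S φ := by
  have hN0 : (N : ℝ) ≠ 0 := by positivity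
  have htelescope := Finset.sum_range_sub (fun k : ℕ => min m (((k : ℝ) + 1) / N)) N
  rw [add_div (N : ℝ), div_self hN0, Nat.cast_zero, zero_add] at htelescope
  calc min m (1 + 1 / N) - 1 / N ≤ min m (1 + 1 / N) - min m (1 / N) :=
        sub_le_sub_left (min_le_right _ _) _
    _ = ∑ k : Fin N, (min m ((((k : ℕ) + 1 : ℕ) + 1 : ℝ) / N) - min m (((k : ℕ) + 1 : ℝ) / N)) := by
        rw [← htelescope, Finset.sum_range]
    _ ≤ reluMin N S φ := Finset.sum_le_sum fun k _ => ?_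
  have hstep : ((((k : ℕ) + 1 : ℕ) : ℝ) + 1) / N = ((k : ℕ) + 1) / N + 1 / N := by
    rw [← add_div]
    push_cast
    ring
  have hpos : (0 : ℝ) ≤ 1 / N := by positivity
  rw [hstep]
  rcases le_total m (((k : ℕ) + 1) / N) with hk | hk
  · rw [min_eq_left hk, min_eq_left (by linarith), sub_self]
    exact relu_nonneg _
  · have hzero : ∑ t ∈ S, relu (((k : ℕ) + 1) / N - φ t) = 0 :=
      Finset.sum_eq_zero fun t ht => max_eq_right (by linarith [hm t ht])
    rw [hzero, min_eq_right hk, sub_zero]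
    exact (by linarith [min_le_right m (((k : ℕ) + 1 : ℝ) / N + 1 / N)] : _ ≤ (1 / N : ℝ)).trans
      (le_max_left _ _)

lemma abs_reluMin_sub_iInf_le (hN : 1 ≤ N) (hS : S.Nonempty) {φ f : Fin T → ℝ}
    (hf : ∀ t, f t ∈ Set.Icc (0 : ℝ) 1) {δ : ℝ} (h : ∀ t, |φ t - f t| ≤ δ) :
    |reluMin N S φ - ⨅ t : {t // t ∈ S}, f t| ≤ δ + 1 / N := by
  obtain ⟨t, ht, hmin⟩ := exists_eq_iInf_mem φ hS
  obtain ⟨s, -, hfs⟩ := exists_eq_iInf_mem f hS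
  have hdist := abs_le.1 (abs_iInf_mem_sub_le φ f hS h)
  have hupper := reluMin_le hN φ ht
  have hlower := le_reluMin (S := S) hN fun t ht => iInf_mem_le φ ht
  have hpos : (0 : ℝ) ≤ 1 / N := by positivity
  have hδ : 0 ≤ δ := (abs_nonneg _).trans (h t)
  have hfmem := hf s
  rw [hfs] at hfmem
  rw [hmin] at hupper
  rw [abs_le]
  constructor <;> grind

end ReluMin

/-! ### ReLU layers computing minima of shallow networks -/

section RetrievalLayers

lemma sum_extend_mul {α β : Type*} [Fintype α] [Fintype β] {f : α → β} (hf : Function.Injective f)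
    (A : α → ℝ) (y : β → ℝ) :
    ∑ q, Function.extend f A 0 q * y q = ∑ j, A j * y (f j) := by
  refine (Fintype.sum_of_injective f hf _ _ (fun q hq => ?_) fun j => ?_).symm
  · rw [Function.extend_apply' _ _ _ hq, Pi.zero_apply, zero_mul]
  · rw [hf.extend_apply]

variable {L c : ℕ} {o : Type} {K : ℝ}

lemma Realizes.sparseReluLayer {ι κ : Type} [Finite ι] [Fintype κ] {α : κ → Type}
    [∀ r, Fintype (α r)] (hK : 0 < K) {g : (κ → ℝ) → o → ℝ}
    (h : Realizes relu unitWeights L c fun z => g (K • z)) {φ : ∀ r, α r → ι}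
    (hφ : ∀ r, Function.Injective (φ r)) {A : ∀ r, α r → ℝ} {b : κ → ℝ}
    (hA : ∀ r j, A r j ∈ unitWeights) (hb : ∀ r, |b r| ≤ K) :
    Realizes relu unitWeights (L + 1) ((∑ r, Fintype.card (α r)) + Fintype.card κ + c)
      fun x => g fun r => relu (∑ j, A r j * (K • x) (φ r j) + b r) := by
  have := Fintype.ofFinite ι
  let B : Matrix κ ι ℝ := Matrix.of fun r => Function.extend (φ r) (A r) 0
  have hB : ∀ r i, B r i ∈ unitWeights := fun r i => by
    by_cases hi : ∃ j, φ r j = i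
    · obtain ⟨j, rfl⟩ := hi
      exact Set.mem_of_eq_of_mem ((hφ r).extend_apply _ _ j) (hA r j)
    · exact Set.mem_of_eq_of_mem (Function.extend_apply' _ _ _ hi) zero_mem_unitWeights
  have hcount : entryCount B (fun r => b r / K) ≤
      (∑ r, Fintype.card (α r)) + Fintype.card κ := by
    refine (entryCount_le (fun p : Σ r, α r => (p.1, φ p.1 p.2)) id (fun r i hBi => ?_)
      (by simp)).trans_eq (by rw [Fintype.card_sigma])
    by_contra hi
    exact hBi (Function.extend_apply' _ _ _ fun ⟨j, hj⟩ => hi ⟨⟨r, j⟩, Prod.ext rfl hj⟩)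
  rw [← rescale_relu hK] at h
  have hlayer := h.rescaledLayer hK.ne' hB (fun r => div_mem_unitWeights (hb r)) hcount
  rw [rescale_relu hK] at hlayer
  have hmulVec : ∀ x r, (B *ᵥ x + b) r = ∑ j, A r j * x (φ r j) + b r := fun x r =>
    congrArg (· + b r) (sum_extend_mul (hφ r) (A r) x)
  simpa only [Function.comp_def, hmulVec] using hlayer

variable {d T D E N : ℕ}

lemma Realizes.comp_threshold (hK : 1 ≤ K) (S : Fin D → Finset (Fin T))
    {g : (Fin D × Fin N → ℝ) → o → ℝ} (h : Realizes relu unitWeights L c fun z => g (K • z)) :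
    Realizes relu unitWeights (L + 1) (D * N * T + D * N + c)
      fun x : Fin D × Fin T × Fin N → ℝ =>
        g fun q => relu (1 / N - ∑ t ∈ S q.1, (K • x) (q.1, t, q.2)) := by
  have hlayer := h.sparseReluLayer (ι := Fin D × Fin T × Fin N) (by linarith)
    (φ := fun q t => (q.1, t, q.2)) (fun _ _ _ ht => congrArg (fun p => p.2.1) ht)
    (A := fun q t => if t ∈ S q.1 then -1 else 0) (b := fun _ => 1 / N)
    (fun q t => by split_ifs <;> simp [unitWeights])
    (fun _ => by
      rw [abs_of_nonneg (by positivity), one_div]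
      exact (Nat.cast_inv_le_one N).trans hK)
  simp only [ite_mul, neg_one_mul, zero_mul, Finset.sum_ite_mem, Finset.univ_inter,
    Finset.sum_neg_distrib, neg_add_eq_sub] at hlayer
  exact hlayer.mono (by simp)

lemma Realizes.comp_readout (hK : 2 ≤ K) {N₁ : Fin D → ShallowNet (Fin d)}
    (hN₁ : ∀ i, (N₁ i).WeightsIn unitWeights) {g : (Fin D × Fin T × Fin N → ℝ) → o → ℝ}
    (h : Realizes relu unitWeights L c fun z => g (K • z)) :
    Realizes relu unitWeights (L + 1) (T * N * (∑ i, (N₁ i).width) + D * (T * N) + c)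
      fun x : Fin T × (Σ i, Fin (N₁ i).width) → ℝ =>
        g fun q => relu (((q.2.2 : ℕ) + 1) / N -
          (((N₁ q.1).outer ⬝ᵥ fun r => (K • x) (q.2.1, ⟨q.1, r⟩)) + (N₁ q.1).const)) := by
  have hbias : ∀ q : Fin D × Fin T × Fin N, |((q.2.2 : ℕ) + 1) / N - (N₁ q.1).const| ≤ K := by
    rintro ⟨i, t, k⟩
    have hlevel : ((k : ℕ) + 1 : ℝ) / N ≤ 1 := by
      rw [div_le_one (Nat.cast_pos.2 k.pos)]
      exact_mod_cast k.2
    have hlevel0 : (0 : ℝ) ≤ ((k : ℕ) + 1 : ℝ) / N := by positivity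
    have hconst := abs_le.1 (abs_le_one_of_mem_unitWeights (hN₁ i).const_mem)
    rw [abs_le]
    constructor <;> linarith
  have hlayer := h.sparseReluLayer (ι := Fin T × (Σ i, Fin (N₁ i).width)) (by linarith)
    (φ := fun q r => (q.2.1, ⟨q.1, r⟩)) (fun q r r' hr => by simpa using hr)
    (A := fun q r => -(N₁ q.1).outer r)
    (fun q r => by simpa [unitWeights, and_comm, neg_le] using (hN₁ q.1).outer_mem r) hbias
  have hneg : ∀ a b c : ℝ, -a + (b - c) = b - (a + c) := fun a b c => by ring
  simp only [neg_mul, Finset.sum_neg_distrib, hneg] at hlayer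
  refine hlayer.mono (le_of_eq ?_)
  simp [Fintype.sum_prod_type, Finset.mul_sum, mul_assoc]

lemma Realizes.comp_blockUnits (hK : 1 ≤ K) (emb : Fin T × Fin d ↪ Fin E)
    {N₁ : Fin D → ShallowNet (Fin d)} (hN₁ : ∀ i, (N₁ i).WeightsIn unitWeights)
    {g : (Fin T × (Σ i, Fin (N₁ i).width) → ℝ) → o → ℝ}
    (h : Realizes relu unitWeights L c fun z => g (K • z)) :
    Realizes relu unitWeights (L + 1) (T * (∑ i, (N₁ i).width) * d + T * (∑ i, (N₁ i).width) + c)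
      fun y : Fin E → ℝ => g fun q => relu
        (((N₁ q.2.1).inner *ᵥ (fun j => (K • y) (emb (q.1, j))) + (N₁ q.2.1).bias) q.2.2) := by
  have hlayer := h.sparseReluLayer (ι := Fin E) (by linarith) (φ := fun q j => emb (q.1, j))
    (fun q => emb.injective.comp (Prod.mk_right_injective q.1))
    (A := fun q => (N₁ q.2.1).inner q.2.2) (b := fun q => (N₁ q.2.1).bias q.2.2)
    (fun q => (hN₁ q.2.1).inner_mem q.2.2)
    (fun q => (abs_le_one_of_mem_unitWeights ((hN₁ q.2.1).bias_mem q.2.2)).trans hK)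
  exact hlayer.mono (by simp)

/-- The number of parameters of the five-layer block `realizes_retrieval`: `w` and `w₀` are the
widths of the inner networks and of the outer one, and `N` is the number of levels. -/
def retrievalCount (d T D N K w w₀ : ℕ) : ℕ :=
  (T * w * d + T * w) + ((T * N * w + D * (T * N)) +
    ((D * N * T + D * N) + (w₀ * K * (D * N + 2) + 1)))

lemma realizes_retrieval {K : ℕ} (hK : 2 ≤ K) (emb : Fin T × Fin d ↪ Fin E)
    (S : Fin D → Finset (Fin T)) {N₀ : ShallowNet (Fin D)} (hN₀ : N₀.WeightsIn unitWeights)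
    {N₁ : Fin D → ShallowNet (Fin d)} (hN₁ : ∀ i, (N₁ i).WeightsIn unitWeights) :
    Realizes relu unitWeights 5 (retrievalCount d T D N K (∑ i, (N₁ i).width) N₀.width)
      fun (y : Fin E → ℝ) (_ : Fin 1) => N₀.eval relu fun i => reluMin N (S i) fun t =>
        (N₁ i).eval relu fun j => ((K : ℝ) • y) (emb (t, j)) := by
  have hK2 : (2 : ℝ) ≤ K := by exact_mod_cast hK
  let outer : (Fin D × Fin N → ℝ) → Fin 1 → ℝ := fun z _ => (N₀.sumFibers (Fin N)).eval relu z
  let minima : (Fin D × Fin T × Fin N → ℝ) → Fin 1 → ℝ := fun z =>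
    outer fun q => relu (1 / N - ∑ t ∈ S q.1, z (q.1, t, q.2))
  let readout : (Fin T × (Σ i, Fin (N₁ i).width) → ℝ) → Fin 1 → ℝ := fun z =>
    minima fun q => relu (((q.2.2 : ℕ) + 1) / N -
      (((N₁ q.1).outer ⬝ᵥ fun r => z (q.2.1, ⟨q.1, r⟩)) + (N₁ q.1).const))
  have houter := (N₀.sumFibers (Fin N)).realizes_smul hN₀.sumFibers (by omega : 1 ≤ K) relu
  rw [rescale_relu (by linarith)] at houter
  have hminima := Realizes.comp_threshold (by linarith) S (g := outer) houter
  have hreadout := Realizes.comp_readout hK2 hN₁ (g := minima) hminima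
  have hblock := Realizes.comp_blockUnits (by linarith) emb hN₁ (g := readout) hreadout
  have hvalue : (fun (y : Fin E → ℝ) (_ : Fin 1) => N₀.eval relu fun i => reluMin N (S i) fun t =>
      (N₁ i).eval relu fun j => ((K : ℝ) • y) (emb (t, j))) = fun y => readout fun q =>
      relu (((N₁ q.2.1).inner *ᵥ (fun j => ((K : ℝ) • y) (emb (q.1, j))) +
        (N₁ q.2.1).bias) q.2.2) := by
    funext y _
    simp only [readout, minima, outer, N₀.eval_sumFibers, reluMin]
    rfl
  rw [hvalue]
  refine hblock.mono (le_of_eq ?_)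
  rw [retrievalCount, Fintype.card_prod, Fintype.card_fin, Fintype.card_fin]
  rfl

end RetrievalLayers

/-! ### One head -/

section SingleHead

/-- The attention layer that averages all tokens. -/
def meanAttention (n : ℕ) : Attention 1 n where
  WQ := 0
  WK := 0
  WV i r q := if q = finProdFinEquiv (i, r) then 1 else 0
  WO := 1
  c₀ := 0
  β := 1

lemma meanAttention_admissible (n : ℕ) : (meanAttention n).Admissible := by
  refine ⟨one_pos, fun i r j => ?_, fun i r j => ?_, fun i r j => ?_, fun r j => ?_⟩
  · simp [meanAttention]
  · simp [meanAttention]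
  · simp only [meanAttention]
    split_ifs <;> simp
  · simp only [meanAttention, Matrix.one_apply]
    split_ifs <;> simp

variable {d T D n N : ℕ}

lemma softmax_zero (β : ℝ) (t : Fin T) : softmax β (fun _ => 0) t = 1 / T := by
  simp [softmax]

lemma meanAttention_out (e : Fin T → Fin (1 * n) → ℝ) (q : Fin (1 * n)) :
    (meanAttention n).out e q = 1 / T * ∑ t, e t q := by
  have hkey : ∀ i x, (meanAttention n).WK i *ᵥ x = 0 := fun _ x => Matrix.zero_mulVec x
  have hvalue : ∀ i x r, ((meanAttention n).WV i *ᵥ x) r = x (finProdFinEquiv (i, r)) := by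
    intro i x r
    simp [meanAttention, Matrix.mulVec, dotProduct]
  have htoken : (meanAttention n).c₀ = 0 := rfl
  have hproj : (meanAttention n).WO = 1 := rfl
  rw [Attention.out, htoken, zero_add, hproj, Matrix.one_mulVec, Attention.concatHeads,
    Attention.head]
  simp only [hkey, dotProduct_zero, softmax_zero, Finset.sum_apply, Pi.smul_apply, hvalue,
    smul_eq_mul, Prod.mk.eta, Equiv.apply_symm_apply, ← Finset.mul_sum]

lemma single_dotProduct_sumElim (x : Fin d → ℝ) (t : Fin T) (k : Fin T × Fin d) :
    Sum.elim (Pi.single k.2 1) (Pi.single k.1 1) ⬝ᵥ Sum.elim x (Pi.single t (1 : ℝ)) =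
      x k.2 + if k.1 = t then 1 else 0 := by
  simp [Pi.single_apply, eq_comm]

lemma relu_add_indicator {p : Prop} [Decidable p] {u : ℝ} (hu : u ∈ Set.Icc (0 : ℝ) 1) :
    relu (u + (if p then 1 else 0) + -1) = if p then u else 0 := by
  split_ifs
  · rw [add_neg_cancel_right]
    exact max_eq_left hu.1
  · exact max_eq_right (by linarith [hu.2])

lemma exists_blockEncoder {E : ℕ} (emb : Fin T × Fin d ↪ Fin E) (s : ℝ) :
    ∃ P : FFN E 2 (d + T), P.paramCount ≤ T * d * (d + T + 2) ∧ ∀ x ∈ cube d, ∀ t : Fin T,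
      encode relu P x t = Function.extend emb (fun k => if k.1 = t then s * x k.2 else 0) 0 := by
  let B : Matrix (Fin E) (Fin T × Fin d) ℝ := Matrix.of fun q k => if emb k = q then s else 0
  have hB : entryCount B 0 ≤ T * d := by
    refine (entryCount_le (fun k => (emb k, k)) Empty.elim (fun q k hqk => ?_)
      (by simp)).trans_eq (by simp)
    exact ⟨k, Prod.ext (ite_ne_right_iff.1 hqk).1 rfl⟩
  have hout : Realizes relu Set.univ 1 (T * d) fun z => B *ᵥ z + 0 :=
    Realizes.output (fun _ _ => Set.mem_univ _) (fun _ => Set.mem_univ _) hB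
  obtain ⟨P, hP, hencode⟩ := (hout.layer (ι := Fin d ⊕ Fin T)
    (A := Matrix.of fun k => Sum.elim (Pi.single k.2 1) (Pi.single k.1 1)) (b := fun _ => -1)
    (fun _ _ => Set.mem_univ _) (fun _ => Set.mem_univ _)
    (entryCount_le_card _ _)).exists_encoder (Equiv.refl (Fin E))
  refine ⟨P, hP.trans_eq ?_, fun x hx t => funext fun q => ?_⟩
  · simp only [Fintype.card_prod, Fintype.card_sum, Fintype.card_fin]
    ring
  have hhidden : relu ∘ ((Matrix.of fun k : Fin T × Fin d =>
      Sum.elim (Pi.single k.2 (1 : ℝ)) (Pi.single k.1 1)) *ᵥ Sum.elim x (Pi.single t 1) +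
        fun _ => -1) = fun k => if k.1 = t then x k.2 else 0 := by
    funext k
    exact (congrArg (fun u => relu (u + -1)) (single_dotProduct_sumElim x t k)).trans
      (relu_add_indicator ⟨hx.1 k.2, hx.2 k.2⟩)
  refine (hencode x t q).trans ?_
  rw [hhidden, add_zero]
  change ∑ k, (if emb k = q then s else 0) * _ = _
  by_cases hq : ∃ k, emb k = q
  · obtain ⟨k, rfl⟩ := hq
    rw [Finset.sum_eq_single k (fun k' _ hk' => by rw [if_neg (emb.injective.ne hk'), zero_mul])
      (by simp), if_pos rfl, emb.injective.extend_apply, mul_ite, mul_zero]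
  · rw [Function.extend_apply' _ _ _ hq]
    exact Finset.sum_eq_zero fun k _ => by rw [if_neg fun hk => hq ⟨k, hk⟩, zero_mul]

lemma sqrt_sum_sq_blockEncoding_le_one {E : ℕ} (hd : 1 ≤ d) (emb : Fin T × Fin d ↪ Fin E)
    {x : Fin d → ℝ} (hx : x ∈ cube d) (t : Fin T) :
    √(∑ q, Function.extend emb (fun k => if k.1 = t then 1 / (2 * d) * x k.2 else 0) 0 q ^ 2) ≤
      1 := by
  have hd1 : (1 : ℝ) ≤ d := by exact_mod_cast hd
  have hterm : ∀ j, (1 / (2 * d) * x j) * (1 / (2 * d) * x j) ≤ (1 / d : ℝ) := fun j => by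
    have hentry : (1 / (2 * d) * x j : ℝ) ∈ Set.Icc 0 (1 / d : ℝ) := by
      refine ⟨mul_nonneg (by positivity) (hx.1 j), ?_⟩
      rw [one_div_mul_eq_div, div_le_div_iff₀ (by positivity) (by positivity)]
      nlinarith [show x j ≤ 1 from hx.2 j]
    exact (mul_le_of_le_one_left hentry.1
      (hentry.2.trans (div_le_one_of_le₀ hd1 (by positivity)))).trans hentry.2
  rw [Real.sqrt_le_left zero_le_one, one_pow]
  simp only [sq, sum_extend_mul emb.injective, emb.injective.extend_apply, Fintype.sum_prod_type]
  rw [Finset.sum_eq_single t (fun t' _ ht' => by simp [ht']) (by simp)]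
  simp only [if_true]
  refine (Finset.sum_le_sum fun j _ => hterm j).trans_eq ?_
  rw [Finset.sum_const, Finset.card_univ, Fintype.card_fin, nsmul_eq_mul, mul_one_div_cancel]
  positivity

/-- The number of parameters of the encoder and the block of the one-head transformer. -/
def singleHeadCount (d T D N w w₀ : ℕ) : ℕ :=
  T * d * (d + T + 2) + retrievalCount d T D N (2 * (d * T)) w w₀

lemma two_mul_smul_meanAttention_out {E : ℕ} (hd : 1 ≤ d) (hT : 1 ≤ T)
    (emb : Fin T × Fin d ↪ Fin (1 * E)) {e : Fin T → Fin (1 * E) → ℝ} {X : Fin T → Fin d → ℝ}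
    (he : ∀ t, e t = Function.extend emb
      (fun k => if k.1 = t then 1 / (2 * d) * X t k.2 else 0) 0) (t : Fin T) (j : Fin d) :
    (((2 * (d * T) : ℕ) : ℝ) • (meanAttention E).out e) (emb (t, j)) = X t j := by
  have hd0 : (d : ℝ) ≠ 0 := by positivity
  have hT0 : (T : ℝ) ≠ 0 := by positivity
  simp only [Pi.smul_apply, meanAttention_out, he, emb.injective.extend_apply, Finset.sum_ite_eq,
    Finset.mem_univ, if_true, smul_eq_mul]
  push_cast
  field_simp

-- Attention with a single averaging head passes the whole sequence, contracted by `2 d T`, to the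
-- feed-forward block, which then evaluates the target itself.
lemma exists_singleHead_approximation (hd : 1 ≤ d) (hT : 1 ≤ T) (hn : T * d ≤ n) (hN : 1 ≤ N)
    {F₀ : (Fin D → ℝ) → ℝ} {f : Fin D → (Fin d → ℝ) → ℝ} {S : Fin D → Finset (Fin T)} {Λ : ℝ≥0}
    (hΛ : LipschitzOnWith Λ F₀ (cube D)) (hf : ∀ i, Set.MapsTo (f i) (cube d) (Set.Icc 0 1))
    (hS : ∀ i, (S i).Nonempty) {δ : ℝ} (hδ : 0 < δ) (hNδ : 1 / (N : ℝ) ≤ δ)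
    (nets : ComponentNets {relu} unitWeights F₀ f δ) :
    ∃ H ∈ hypothesisClass {relu} 2 5 1 n d T
      (singleHeadCount d T D N (∑ i, (nets.net i).width) nets.outerNet.width),
      ∀ X ∈ inputSpace d T, |H X - retrievalTarget F₀ f S X| ≤ δ + Λ * (3 * δ) := by
  obtain ⟨emb⟩ : Nonempty (Fin T × Fin d ↪ Fin (1 * n)) :=
    Function.Embedding.nonempty_of_card_le (by simpa using hn)
  obtain ⟨P, hP, hencode⟩ := exists_blockEncoder emb (1 / (2 * d))
  obtain ⟨G, hGW, hG, heval⟩ := realizes_retrieval (N := N)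
    (show 2 ≤ 2 * (d * T) by nlinarith [Nat.mul_le_mul hd hT]) emb S nets.outerNet_weightsIn
    nets.net_weightsIn (Equiv.refl _) (Equiv.refl _)
  refine ⟨_, ⟨relu, rfl, relu, rfl, P, meanAttention n, G, fun x hx t => ?_,
    meanAttention_admissible n, hGW, add_le_add hP hG, rfl⟩, fun X hX => ?_⟩
  · rw [hencode x hx t]
    exact sqrt_sum_sq_blockEncoding_le_one hd emb hx t
  have hvalue : G.eval relu ((meanAttention n).out fun t => encode relu P (X t) t) 0 =
      nets.outerNet.eval relu fun i => reluMin N (S i) fun t => (nets.net i).eval relu (X t) := by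
    refine (heval _ 0).trans ?_
    have hread := two_mul_smul_meanAttention_out hd hT emb fun t => hencode (X t) (hX t) t
    exact congrArg (nets.outerNet.eval relu) (funext fun i => congrArg (reluMin N (S i))
      (funext fun t => congrArg ((nets.net i).eval relu) (funext (hread t))))
  have hinner : ∀ i, ∀ x ∈ cube d, |f i x - (nets.net i).eval relu x| ≤ δ := fun i => by
    simpa only [show nets.act i = relu from nets.act_mem i] using nets.abs_sub_net_le i
  have houter : ∀ z ∈ cube D, |F₀ z - nets.outerNet.eval relu z| ≤ δ := by
    simpa only [show nets.outerAct = relu from nets.outerAct_mem] using nets.abs_sub_outerNet_le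
  have hmem := mem_cube_iff.2 fun i =>
    reluMin_mem_Icc N (S i) fun t => (nets.net i).eval relu (X t)
  rw [hvalue]
  refine abs_sub_retrievalTarget_le hΛ hf hS hX hmem (by positivity) (fun i => ?_)
    (houter _ hmem)
  refine (abs_reluMin_sub_iInf_le hN (hS i) (fun t => hf i (hX t)) fun t => ?_).trans
    (by linarith : δ + 1 / (N : ℝ) ≤ 3 * δ)
  rw [abs_sub_comm]
  exact hinner i (X t) (hX t)

lemma singleHeadCount_le (w w₀ : ℕ) :
    singleHeadCount d T D N w w₀ ≤ (T * d * (d + T + 2) + T * d + T + D * (2 * T + 1) +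
      2 * (d * T) * (D + 2) + 1) * ((N + 1) * (w₀ + w + 1)) := by
  set k := (N + 1) * (w₀ + w + 1) with hk
  have hone : 1 ≤ k := by nlinarith
  have hN : N ≤ k := by nlinarith
  have hw : w + N * w ≤ k := by nlinarith
  have hw₀ : w₀ * (D * N + 2) ≤ (D + 2) * k :=
    calc w₀ * (D * N + 2) ≤ w₀ * ((D + 2) * (N + 1)) := by gcongr; nlinarith
      _ = (D + 2) * ((N + 1) * w₀) := by ring
      _ ≤ (D + 2) * k := by rw [hk]; gcongr; omega
  calc singleHeadCount d T D N w w₀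
      = T * d * (d + T + 2) * 1 + T * d * w + T * (w + N * w) + D * (2 * T + 1) * N +
          2 * (d * T) * (w₀ * (D * N + 2)) + 1 := by
        rw [singleHeadCount, retrievalCount]
        ring
    _ ≤ T * d * (d + T + 2) * k + T * d * k + T * k + D * (2 * T + 1) * k +
          2 * (d * T) * ((D + 2) * k) + k := by
        gcongr
        exact (Nat.le_add_right w _).trans hw
    _ = _ := by ring

lemma assembles_singleHead (hd : 1 ≤ d) (hT : 1 ≤ T) (hn : T * d ≤ n) (R : ℝ) :
    Assembles {relu} unitWeights (hypothesisClass {relu} 2 5 1 n d T) D R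
      ((T * d * (d + T + 2) + T * d + T + D * (2 * T + 1) + 2 * (d * T) * (D + 2) + 1 : ℕ) *
        (1 + 2 * R)) 1 := by
  intro F₀ f S Λ hΛ hf hS δ hδ hδR nets
  set N := ⌈1 / δ⌉₊
  have hNδ : 1 / δ ≤ N := Nat.le_ceil _
  have hN : 1 ≤ N := Nat.one_le_ceil_iff.2 (by positivity)
  have hN1 : ((N + 1 : ℕ) : ℝ) ≤ (1 + 2 * R) / δ := by
    have hceil : (N : ℝ) < 1 / δ + 1 := Nat.ceil_lt_add_one (by positivity)
    calc ((N + 1 : ℕ) : ℝ) ≤ 1 / δ + 2 := by push_cast; linarith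
      _ = (1 + 2 * δ) / δ := by field_simp
      _ ≤ (1 + 2 * R) / δ := by gcongr
  refine ⟨_, ?_, exists_singleHead_approximation hd hT hn hN hΛ hf hS hδ
    ((one_div_le (by positivity) hδ).2 hNδ) nets⟩
  refine (Nat.cast_le.2 (singleHeadCount_le _ _)).trans ?_
  rw [Nat.cast_mul, Nat.cast_mul (N + 1), pow_one, mul_assoc (Nat.cast _), mul_div_assoc,
    mul_div_right_comm]
  exact mul_le_mul_of_nonneg_left (mul_le_mul_of_nonneg_right hN1 (Nat.cast_nonneg _))
    (Nat.cast_nonneg _)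

theorem singleHead_upper_bound (hd : 1 ≤ d) (hT : 1 ≤ T) {C₁ γ₁ C₂ : ℝ} (γ₂ : ℝ) (Λ : ℝ≥0)
    (hC₁ : 0 < C₁) (hγ₁ : 0 < γ₁) (hC₂ : 0 < C₂) :
    ∃ C : ℝ, 0 < C ∧ ∀ n : ℕ, T * d ≤ n → ∀ ε : ℝ, 0 < ε → ∀ M : ℕ,
      C / ε ^ (1 + max γ₁ γ₂) < M →
        EpsApproximates (hypothesisClass {relu} 2 5 1 n d T M) ε
          (approxTargetClass {relu} unitWeights d T D C₁ γ₁ C₂ γ₂ Λ) := by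
  obtain ⟨C, hC, hrate⟩ := exists_rate_of_assembles (𝒜 := {relu}) (W := unitWeights)
    (d := d) (D := D) (γ₂ := γ₂) (B := (T * d * (d + T + 2) + T * d + T + D * (2 * T + 1) +
      2 * (d * T) * (D + 2) + 1 : ℕ) * (1 + 2 * (1 + (C₁ + 1) ^ (1 / γ₁)))) (Λ := Λ) (θ := 1) hT hC₁
    hγ₁ hC₂ (by positivity) ⟨relu, rfl⟩
  simp only [Nat.cast_one] at hrate
  exact ⟨C, hC, fun n hn => hrate 4 1 n (assembles_singleHead hd hT hn _)⟩

end SingleHead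

/-! ### Retrieval tasks near the minima of their components -/

section Probes

open scoped Topology

lemma convex_cube (m : ℕ) : Convex ℝ (cube m) := convex_Icc 0 1

lemma uniqueDiffOn_cube (m : ℕ) : UniqueDiffOn ℝ (cube m) := by
  have hpi : cube m = Set.univ.pi fun _ => Set.Icc (0 : ℝ) 1 := (Set.pi_univ_Icc 0 1).symm
  rw [hpi]
  exact UniqueDiffOn.univ_pi fun _ => uniqueDiffOn_Icc_zero_one

lemma update_mem_cube {m : ℕ} {z : Fin m → ℝ} (hz : z ∈ cube m) {i : Fin m} {a : ℝ}
    (ha : a ∈ Set.Icc (0 : ℝ) 1) : Function.update z i a ∈ cube m :=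
  mem_cube_iff.2 ((Function.forall_update_iff z fun _ b => b ∈ Set.Icc (0 : ℝ) 1).2
    ⟨ha, fun j _ => mem_cube_iff.1 hz j⟩)

lemma update_sub_update {ι : Type} [DecidableEq ι] (z : ι → ℝ) (i : ι) (a b : ℝ) :
    Function.update z i a - Function.update z i b = (a - b) • Pi.single i 1 := by
  ext j
  obtain rfl | hj := eq_or_ne j i
  · simp
  · simp [hj]

lemma exists_mem_nhdsWithin_lipschitzOnWith_sub {m : ℕ} {g : (Fin m → ℝ) → ℝ}
    (hg : ContDiffOn ℝ 1 g (cube m)) {z : Fin m → ℝ} (hz : z ∈ cube m) {c : ℝ≥0} (hc : 0 < c) :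
    ∃ t ∈ 𝓝[cube m] z, LipschitzOnWith c (fun x => g x - fderivWithin ℝ g (cube m) z x) t := by
  refine (convex_cube m).exists_nhdsWithin_lipschitzOnWith_of_hasFDerivWithinAt_of_nnnorm_lt
    (f' := fun x => fderivWithin ℝ g (cube m) x - fderivWithin ℝ g (cube m) z)
    (Filter.eventually_of_mem self_mem_nhdsWithin fun x hx =>
      (hg.differentiableOn one_ne_zero x hx).hasFDerivWithinAt.sub
        (ContinuousLinearMap.hasFDerivWithinAt _))
    ((hg.continuousOn_fderivWithin (uniqueDiffOn_cube m) le_rfl z hz).sub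
      continuousWithinAt_const) c (by simpa using hc)

lemma exists_mul_abs_sub_le_of_partial_ne_zero {m : ℕ} {g : (Fin m → ℝ) → ℝ}
    (hg : ContDiffOn ℝ 1 g (cube m)) {z : Fin m → ℝ} (hz : z ∈ cube m) {i : Fin m}
    (hne : fderivWithin ℝ g (cube m) z (Pi.single i 1) ≠ 0) :
    ∃ κ : ℝ, 0 < κ ∧ ∃ ρ : ℝ, 0 < ρ ∧ ∀ a ∈ Set.Icc (0 : ℝ) 1, ∀ b ∈ Set.Icc (0 : ℝ) 1,
      |a - z i| < ρ → |b - z i| < ρ →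
        κ * |a - b| ≤ |g (Function.update z i a) - g (Function.update z i b)| := by
  set L := fderivWithin ℝ g (cube m) z with hL
  have hpos : 0 < ‖L (Pi.single i 1)‖ := norm_pos_iff.2 hne
  obtain ⟨t, ht, hlip⟩ := exists_mem_nhdsWithin_lipschitzOnWith_sub hg hz
    (c := ‖L (Pi.single i 1)‖₊ / 2) (half_pos hpos)
  obtain ⟨ρ, hρ, hball⟩ := Metric.mem_nhdsWithin_iff.1 ht
  refine ⟨_, half_pos hpos, ρ, hρ, fun a ha b hb haρ hbρ => ?_⟩
  have mem_t : ∀ a ∈ Set.Icc (0 : ℝ) 1, |a - z i| < ρ → Function.update z i a ∈ t := by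
    refine fun a ha haρ => hball ⟨?_, update_mem_cube hz ha⟩
    have hdist := congrArg norm (update_sub_update z i a (z i))
    rw [Function.update_eq_self, norm_smul, Pi.norm_single, norm_one, mul_one] at hdist
    exact mem_ball_iff_norm.2 (hdist.trans_lt haρ)
  have hdev := hlip.dist_le_mul _ (mem_t a ha haρ) _ (mem_t b hb hbρ)
  rw [dist_eq_norm, dist_eq_norm, sub_sub_sub_comm, ← map_sub, update_sub_update, map_smul,
    norm_smul, Pi.norm_single, norm_one, mul_one] at hdev
  have htriangle := norm_le_norm_add_norm_sub
    (g (Function.update z i a) - g (Function.update z i b)) ((a - b) • L (Pi.single i 1))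
  rw [norm_smul] at htriangle
  simp only [NNReal.coe_div, NNReal.coe_ofNat, coe_nnnorm, ← hL] at hdev
  simp only [Real.norm_eq_abs] at *
  linarith

variable {d T D : ℕ} {F₀ : (Fin D → ℝ) → ℝ} {f : Fin D → (Fin d → ℝ) → ℝ}
  {S : Fin D → Finset (Fin T)} {xmin : Fin D → Fin d → ℝ}

lemma IsRetrievalTask.apply_xmin_le (h : IsRetrievalTask F₀ f S xmin) (i : Fin D) {y : Fin d → ℝ}
    (hy : y ∈ cube d) : f i (xmin i) ≤ f i y := by
  obtain rfl | hne := eq_or_ne y (xmin i)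
  · rfl
  · exact (h.unique_min i y hy hne).le

lemma IsRetrievalTask.exists_slope (h : IsRetrievalTask F₀ f S xmin) (i : Fin D) :
    ∃ κ : ℝ, 0 < κ ∧ ∀ᶠ ρ in 𝓝[>] (0 : ℝ), ∀ y ∈ cube d, ∀ y' ∈ cube d,
      f i y ≤ f i (xmin i) + ρ → f i y' ≤ f i (xmin i) + ρ →
        κ * |f i y - f i y'| ≤ |F₀ (Function.update (fun j => f j (xmin j)) i (f i y)) -
          F₀ (Function.update (fun j => f j (xmin j)) i (f i y'))| := by
  obtain ⟨κ, hκ, ρ₀, hρ₀, hslope⟩ := exists_mul_abs_sub_le_of_partial_ne_zero h.contDiffOn_outer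
    (mem_cube_iff.2 fun j => h.mapsTo_comp j (h.xmin_mem j)) (h.partial_ne_zero i)
  refine ⟨κ, hκ, Filter.eventually_of_mem (Ioo_mem_nhdsGT hρ₀) fun ρ hρ y hy y' hy' hyρ hyρ' => ?_⟩
  have close : ∀ y ∈ cube d, f i y ≤ f i (xmin i) + ρ → |f i y - f i (xmin i)| < ρ₀ := by
    intro y hy hyρ
    rw [abs_of_nonneg (sub_nonneg.2 (h.apply_xmin_le i hy))]
    linarith [hρ.2]
  exact hslope _ (h.mapsTo_comp i hy) _ (h.mapsTo_comp i hy') (close y hy hyρ) (close y' hy' hyρ')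

lemma IsRetrievalTask.eventually_exists_level_point (h : IsRetrievalTask F₀ f S xmin) (hD : 2 ≤ D)
    (i : Fin D) : ∀ᶠ ρ in 𝓝[>] (0 : ℝ), ∀ u ∈ Set.Icc 0 ρ, ∃ y ∈ cube d,
      f i y = f i (xmin i) + u ∧ ∀ j ≠ i, f j (xmin j) + ρ ≤ f j y := by
  have hcont : ∀ j, ContinuousOn (f j) (cube d) := fun j => (h.contDiffOn_comp j).continuousOn
  obtain ⟨δ, hδ, hδlt⟩ : ∃ δ : ℝ, 0 < δ ∧ ∀ j : {j // j ≠ i}, f j (xmin j) + δ < f j (xmin i) :=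
    Pi.exists_forall_pos_add_lt fun j =>
      h.unique_min j _ (h.xmin_mem i) (h.xmin_injective.ne j.2.symm)
  obtain ⟨r, hr, hnear⟩ := Metric.mem_nhdsWithin_iff.1 (Filter.eventually_all.2
    fun j : {j // j ≠ i} => (hcont j _ (h.xmin_mem i)).eventually (lt_mem_nhds (hδlt j)))
  obtain ⟨y₁, ⟨hy₁r, hy₁⟩, hne⟩ : ∃ y ∈ Metric.ball (xmin i) r ∩ cube d, y ≠ xmin i := by
    have : Nontrivial (Fin D) := Fin.nontrivial_iff_two_le.2 hD
    obtain ⟨i', hi'⟩ := exists_ne i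
    exact accPt_iff_nhds.1 ((convex_cube d).isPreconnected.preperfect_of_nontrivial
      ⟨_, h.xmin_mem i', _, h.xmin_mem i, h.xmin_injective.ne hi'⟩ _ (h.xmin_mem i)) _
      (Metric.ball_mem_nhds _ hr)
  have hrise : 0 < f i y₁ - f i (xmin i) := sub_pos.2 (h.unique_min i y₁ hy₁ hne)
  refine Filter.eventually_of_mem (Ioo_mem_nhdsGT (lt_min hδ hrise)) fun ρ hρ u hu => ?_
  obtain ⟨hρδ, hρrise⟩ := lt_min_iff.1 hρ.2
  obtain ⟨y, ⟨hyr, hy⟩, hyu⟩ := ((convex_ball (xmin i) r).inter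
    (convex_cube d)).isPreconnected.intermediate_value ⟨Metric.mem_ball_self hr, h.xmin_mem i⟩
    ⟨hy₁r, hy₁⟩ ((hcont i).mono Set.inter_subset_right)
    (show f i (xmin i) + u ∈ Set.Icc (f i (xmin i)) (f i y₁) from
      ⟨by linarith [hu.1], by linarith [hu.2]⟩)
  refine ⟨y, hy, hyu, fun j hj => ?_⟩
  have hfar : f j (xmin j) + δ < f j y := hnear ⟨hyr, hy⟩ ⟨j, hj⟩
  linarith

/-- Test tokens for a retrieval task. For each component `fᵢ` and each level `u ∈ [0, ρ]`, the
token `point i u` raises `fᵢ` by `u` above its minimum while every other component stays at least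
`ρ` above its own minimum, and the target responds to such levels at rate at least `κ`. -/
structure IsProbe (F₀ : (Fin D → ℝ) → ℝ) (f : Fin D → (Fin d → ℝ) → ℝ) (xmin : Fin D → Fin d → ℝ)
    (κ ρ : ℝ) (point : Fin D → ℝ → Fin d → ℝ) : Prop where
  rate_pos : 0 < κ
  height_pos : 0 < ρ
  point_mem : ∀ i, ∀ u ∈ Set.Icc 0 ρ, point i u ∈ cube d
  apply_point : ∀ i, ∀ u ∈ Set.Icc 0 ρ, f i (point i u) = f i (xmin i) + u
  le_apply_point : ∀ i, ∀ u ∈ Set.Icc 0 ρ, ∀ j ≠ i, f j (xmin j) + ρ ≤ f j (point i u)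
  rate_le : ∀ i, ∀ u ∈ Set.Icc 0 ρ, ∀ v ∈ Set.Icc 0 ρ, κ * |u - v| ≤
    |F₀ (Function.update (fun j => f j (xmin j)) i (f i (xmin i) + u)) -
      F₀ (Function.update (fun j => f j (xmin j)) i (f i (xmin i) + v))|

lemma IsRetrievalTask.exists_isProbe (h : IsRetrievalTask F₀ f S xmin) (hD : 2 ≤ D) :
    ∃ κ ρ point, IsProbe F₀ f xmin κ ρ point := by
  have : Nonempty (Fin D) := ⟨⟨0, by omega⟩⟩
  choose κ hκ hslope using h.exists_slope
  obtain ⟨i₀, hi₀⟩ := Finite.exists_min κ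
  obtain ⟨ρ, ⟨hslope, hlevel⟩, hρ⟩ := (((Filter.eventually_all.2 hslope).and
    (Filter.eventually_all.2 (h.eventually_exists_level_point hD))).and
    self_mem_nhdsWithin).exists
  choose! point hmem hi hj using hlevel
  refine ⟨κ i₀, ρ, point, hκ i₀, hρ, hmem, hi, hj, fun i u hu v hv => ?_⟩
  have hrate := hslope i _ (hmem i u hu) _ (hmem i v hv)
  rw [hi i u hu, hi i v hv, add_sub_add_left_eq_sub] at hrate
  exact (mul_le_mul_of_nonneg_right (hi₀ i) (abs_nonneg _)).trans
    (hrate (add_le_add_right hu.2 _) (add_le_add_right hv.2 _))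

end Probes

/-! ### Freezing tokens that dominate the attention scores -/

section Background

-- The tokens are chosen greedily: each new score is maximized over the positions still free.
lemma exists_dominating {J K ι : Type} [Finite K] [Nonempty K] [Finite ι] [Nonempty ι]
    (sc : J → ι → K → ℝ) (s : Finset J) :
    ∃ (U : Finset ι) (κ : ι → K), U.card ≤ s.card ∧
      ∀ j ∈ s, ∃ u ∈ U, ∀ t ∉ U, ∀ k, sc j t k ≤ sc j u (κ u) := by
  classical
  induction s using Finset.induction_on with
  | empty => exact ⟨∅, Classical.arbitrary _, le_rfl, by simp⟩
  | insert j s hj ih =>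
    obtain ⟨U, κ, hU, hdom⟩ := ih
    rw [Finset.card_insert_of_notMem hj]
    by_cases hfull : ∀ t, t ∈ U
    · exact ⟨U, κ, hU.trans (Nat.le_succ _), fun _ _ =>
        ⟨Classical.arbitrary ι, hfull _, fun t ht => absurd (hfull t) ht⟩⟩
    obtain ⟨t₀, ht₀⟩ := not_forall.1 hfull
    have : Nonempty {t // t ∉ U} := ⟨⟨t₀, ht₀⟩⟩
    obtain ⟨⟨⟨t₁, ht₁⟩, k₁⟩, hmax⟩ := Finite.exists_max fun q : {t // t ∉ U} × K => sc j q.1 q.2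
    refine ⟨insert t₁ U, Function.update κ t₁ k₁,
      (Finset.card_insert_le _ _).trans (Nat.succ_le_succ hU), fun j' hj' => ?_⟩
    simp only [Finset.mem_insert, not_or]
    obtain rfl | hj' := Finset.mem_insert.1 hj'
    · refine ⟨t₁, Or.inl rfl, fun t ht k => ?_⟩
      rw [Function.update_self]
      exact hmax (⟨t, ht.2⟩, k)
    · obtain ⟨u, hu, hle⟩ := hdom j' hj'
      refine ⟨u, Or.inr hu, fun t ht k => ?_⟩
      rw [Function.update_of_ne fun hut : u = t₁ => ht₁ (hut ▸ hu)]
      exact hle t ht.2 k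

lemma exists_dominating_avoiding {ι K : Type} [Finite K] [Nonempty K] [Finite ι] [Nonempty ι]
    {s D : ℕ} (hsD : s < D) (sc : Fin s → ι → Fin D × K → ℝ) :
    ∃ (i₁ : Fin D) (U : Finset ι) (κ : ι → Fin D × K), U.card ≤ s ∧ (∀ t ∈ U, (κ t).1 ≠ i₁) ∧
      ∀ j, ∃ u ∈ U, ∀ t ∉ U, ∀ k, sc j t k ≤ sc j u (κ u) := by
  classical
  have : Nonempty (Fin D) := ⟨⟨s, hsD⟩⟩
  obtain ⟨U, κ, hU, hdom⟩ := exists_dominating sc Finset.univ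
  rw [Finset.card_univ, Fintype.card_fin] at hU
  obtain ⟨i₁, -, hi₁⟩ := Finset.exists_mem_notMem_of_card_lt_card
    (s := U.image fun t => (κ t).1) (t := Finset.univ)
    (by simpa using Finset.card_image_le.trans_lt (hU.trans_lt hsD))
  exact ⟨i₁, U, κ, hU, fun t ht hi => hi₁ (Finset.mem_image.2 ⟨t, ht, hi⟩),
    fun j => hdom j (Finset.mem_univ j)⟩

lemma exists_representatives_notMem {ι α : Type} [Fintype ι] (S : ι → Finset α) (U : Finset α)
    (h : ∀ i, U.card + Fintype.card ι ≤ (S i).card) :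
    ∃ g : ι → α, Function.Injective g ∧ ∀ i, g i ∈ S i ∧ g i ∉ U := by
  classical
  obtain ⟨g, hg, hmem⟩ := (Finset.all_card_le_biUnion_card_iff_exists_injective
    fun i => S i \ U).1 fun s => by
      obtain rfl | ⟨i, hi⟩ := s.eq_empty_or_nonempty
      · exact Nat.zero_le _
      calc s.card ≤ Fintype.card ι := s.card_le_univ
        _ ≤ (S i).card - U.card := Nat.le_sub_of_add_le' (h i)
        _ ≤ (S i \ U).card := Finset.le_card_sdiff _ _
        _ ≤ _ := Finset.card_le_card (Finset.subset_biUnion_of_mem (fun i => S i \ U) hi)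
  exact ⟨g, hg, fun i => Finset.mem_sdiff.1 (hmem i)⟩

variable {d T D : ℕ} {F₀ : (Fin D → ℝ) → ℝ} {f : Fin D → (Fin d → ℝ) → ℝ}
  {S : Fin D → Finset (Fin T)} {xmin : Fin D → Fin d → ℝ} {κ ρ : ℝ}
  {point : Fin D → ℝ → Fin d → ℝ}

/-- An input `X₀` that leaves only the component `f i₁` open: its tokens at the positions in `W`
already realize the minima of all the other components, and no token brings `f i₁` within less than
`ρ` of its minimum. The target then depends only on how the remaining positions lower `f i₁`. -/
structure IsBackground (f : Fin D → (Fin d → ℝ) → ℝ) (S : Fin D → Finset (Fin T))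
    (xmin : Fin D → Fin d → ℝ) (ρ : ℝ) (i₁ : Fin D) (W : Finset (Fin T))
    (X₀ : Fin T → Fin d → ℝ) : Prop where
  mem_inputSpace : X₀ ∈ inputSpace d T
  add_le_apply : ∀ t, f i₁ (xmin i₁) + ρ ≤ f i₁ (X₀ t)
  exists_eq_min : ∀ i ≠ i₁, ∃ t ∈ W, t ∈ S i ∧ f i (X₀ t) = f i (xmin i)

lemma IsProbe.exists_isBackground (hp : IsProbe F₀ f xmin κ ρ point) (hD : 2 ≤ D)
    {i₁ : Fin D} {U : Finset (Fin T)} {i : Fin T → Fin D} {u : Fin T → ℝ}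
    (hi : ∀ t ∈ U, i t ≠ i₁) (hu : ∀ t, u t ∈ Set.Icc 0 ρ)
    (hS : ∀ i, U.card + D ≤ (S i).card + 1) :
    ∃ W X₀, U ⊆ W ∧ W.card + 1 ≤ U.card + D ∧ IsBackground f S xmin ρ i₁ W X₀ ∧
      ∀ t ∈ U, X₀ t = point (i t) (u t) := by
  classical
  have hcard : Fintype.card {i // i ≠ i₁} + 1 = D := by
    rw [Fintype.card_subtype_compl, Fintype.card_subtype_eq, Fintype.card_fin]
    omega
  obtain ⟨g, hg, hgmem⟩ := exists_representatives_notMem (ι := {i // i ≠ i₁}) (fun i => S i) U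
    fun i => by have := hS i; omega
  have : Nontrivial (Fin D) := Fin.nontrivial_iff_two_le.2 hD
  obtain ⟨i₀, hi₀⟩ := exists_ne i₁
  let X₀ : Fin T → Fin d → ℝ := U.piecewise (fun t => point (i t) (u t))
    (Function.extend g (fun i => point i 0) fun _ => point i₀ 0)
  have h0 : (0 : ℝ) ∈ Set.Icc 0 ρ := ⟨le_rfl, hp.height_pos.le⟩
  have hX₀ : ∀ t, ∃ i ≠ i₁, ∃ v ∈ Set.Icc 0 ρ, X₀ t = point i v := by
    intro t
    by_cases htU : t ∈ U
    · exact ⟨i t, hi t htU, u t, hu t, Finset.piecewise_eq_of_mem _ _ _ htU⟩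
    simp only [X₀, Finset.piecewise_eq_of_notMem _ _ _ htU]
    by_cases htg : ∃ i, g i = t
    · obtain ⟨i, rfl⟩ := htg
      exact ⟨i, i.2, 0, h0, hg.extend_apply _ _ _⟩
    · exact ⟨i₀, hi₀, 0, h0, Function.extend_apply' _ _ _ htg⟩
  refine ⟨U ∪ Finset.univ.image g, X₀, Finset.subset_union_left, ?_,
    ⟨fun t => ?_, fun t => ?_, fun i hi => ?_⟩, fun t ht => Finset.piecewise_eq_of_mem _ _ _ ht⟩
  · have hunion := Finset.card_union_le U (Finset.univ.image g)
    rw [Finset.card_image_of_injective _ hg, Finset.card_univ] at hunion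
    omega
  · obtain ⟨i, -, v, hv, ht⟩ := hX₀ t
    exact ht ▸ hp.point_mem i v hv
  · obtain ⟨i, hi, v, hv, ht⟩ := hX₀ t
    exact ht ▸ hp.le_apply_point i v hv i₁ hi.symm
  · refine ⟨g ⟨i, hi⟩, Finset.mem_union_right _ (Finset.mem_image_of_mem _ (Finset.mem_univ _)),
      (hgmem ⟨i, hi⟩).1, ?_⟩
    simp only [X₀, Finset.piecewise_eq_of_notMem _ _ _ (hgmem ⟨i, hi⟩).2, hg.extend_apply]
    rw [hp.apply_point i 0 h0, add_zero]

lemma IsProbe.exists_dominating_background (hp : IsProbe F₀ f xmin κ ρ point) (hT : 1 ≤ T)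
    {s : ℕ} (hs : 1 ≤ s) (hsD : s < D) (hS : ∀ i, s + D ≤ (S i).card + 1)
    (sc : Fin s → Fin T → (Fin d → ℝ) → ℝ) {K : Type} [Finite K] [Nonempty K] {level : K → ℝ}
    (hlevel : ∀ k, level k ∈ Set.Icc 0 ρ) :
    ∃ i₁ W X₀, W.card + 1 ≤ s + D ∧ IsBackground f S xmin ρ i₁ W X₀ ∧
      ∀ j, ∃ u ∈ W, ∀ t ∉ W, ∀ k, sc j t (point i₁ (level k)) ≤ sc j u (X₀ u) := by
  have : Nonempty (Fin T) := ⟨⟨0, hT⟩⟩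
  obtain ⟨i₁, U, κ, hU, hne, hdom⟩ :=
    exists_dominating_avoiding hsD fun j t k => sc j t (point k.1 (level k.2))
  obtain ⟨W, X₀, hUW, hW, hX₀, hX₀U⟩ := hp.exists_isBackground (S := S) (by omega)
    (u := fun t => level (κ t).2) hne (fun t => hlevel _) fun i => by have := hS i; omega
  refine ⟨i₁, W, X₀, by omega, hX₀, fun j => ?_⟩
  obtain ⟨u, hu, hle⟩ := hdom j
  refine ⟨u, hUW hu, fun t ht k => ?_⟩
  rw [hX₀U u hu]
  exact hle t (fun htU => ht (hUW htU)) (i₁, k)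

lemma iInf_mem_eq_of_forall_le {v : Fin T → ℝ} {A : Finset (Fin T)} {t : Fin T} (ht : t ∈ A)
    (h : ∀ t' ∈ A, v t ≤ v t') : ⨅ t : {t // t ∈ A}, v t = v t := by
  obtain ⟨t', ht', heq⟩ := exists_eq_iInf_mem v ⟨t, ht⟩
  exact le_antisymm (iInf_mem_le v ht) (heq ▸ h t' ht')

lemma IsBackground.exists_retrievalTarget_piecewise (h : IsRetrievalTask F₀ f S xmin)
    (hp : IsProbe F₀ f xmin κ ρ point) {i₁ : Fin D} {W : Finset (Fin T)} {X₀ : Fin T → Fin d → ℝ}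
    (hX₀ : IsBackground f S xmin ρ i₁ W X₀) {C : Finset (Fin T)} (hC : C.Nonempty)
    (hCS : C ⊆ S i₁) (hCW : Disjoint C W) {v : Fin T → ℝ} (hv : ∀ t, v t ∈ Set.Icc 0 ρ) :
    ∃ t ∈ C, retrievalTarget F₀ f S (C.piecewise (fun t => point i₁ (v t)) X₀) =
      F₀ (Function.update (fun j => f j (xmin j)) i₁ (f i₁ (xmin i₁) + v t)) := by
  set X := C.piecewise (fun t => point i₁ (v t)) X₀ with hX
  have hXmem : ∀ t, X t ∈ cube d := fun t =>
    C.piecewise_cases (fun t => point i₁ (v t)) X₀ (· ∈ cube d) (hp.point_mem i₁ _ (hv t))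
      (hX₀.mem_inputSpace t)
  have hXC : ∀ t ∈ C, f i₁ (X t) = f i₁ (xmin i₁) + v t := fun t ht => by
    rw [hX, Finset.piecewise_eq_of_mem _ _ _ ht, hp.apply_point i₁ _ (hv t)]
  obtain ⟨t₀, ht₀, hmin⟩ := C.exists_min_image v hC
  refine ⟨t₀, ht₀, congrArg F₀ (funext fun i => ?_)⟩
  obtain rfl | hi := eq_or_ne i i₁
  · rw [Function.update_self, ← hXC t₀ ht₀]
    refine iInf_mem_eq_of_forall_le (v := fun t => f i (X t)) (hCS ht₀) fun t _ => ?_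
    rw [hXC t₀ ht₀]
    by_cases ht : t ∈ C
    · rw [hXC t ht]
      exact add_le_add_right (hmin t ht) _
    · rw [hX, Finset.piecewise_eq_of_notMem _ _ _ ht]
      exact (add_le_add_right (hv t₀).2 _).trans (hX₀.add_le_apply t)
  · obtain ⟨t, htW, htS, ht⟩ := hX₀.exists_eq_min i hi
    rw [← Finset.piecewise_eq_of_notMem C (fun t => point i₁ (v t)) X₀
      fun htC => Finset.disjoint_left.1 hCW htC htW, ← hX] at ht
    rw [Function.update_of_ne hi, ← ht]
    exact iInf_mem_eq_of_forall_le (v := fun t => f i (X t)) htS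
      fun t' _ => ht ▸ h.apply_xmin_le i (hXmem t')

end Background

/-! ### Pigeonhole for bounded sums -/

section Pigeonhole

lemma exists_cell {B : ℕ} (hB : 1 ≤ B) (R : ℝ) :
    ∃ cell : ℝ → Fin B, ∀ x y, |x| ≤ R → |y| ≤ R → cell x = cell y → |x - y| ≤ 2 * R / B := by
  obtain hR | hR := le_or_gt R 0
  · refine ⟨fun _ => ⟨0, hB⟩, fun x y hx hy _ => ?_⟩
    obtain rfl : x = 0 := abs_nonpos_iff.1 (hx.trans hR)
    obtain rfl : y = 0 := abs_nonpos_iff.1 (hy.trans hR)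
    simpa using div_nonneg (mul_nonneg zero_le_two ((abs_nonneg _).trans hx)) B.cast_nonneg
  have : (0 : ℝ) < B := Nat.cast_pos.2 hB
  let scale : ℝ → ℝ := fun x => (x + R) * (B / (2 * R))
  have hcell : ∀ x, |x| ≤ R →
      scale x ∈ Set.Icc ((min ⌊scale x⌋₊ (B - 1) : ℕ) : ℝ) ((min ⌊scale x⌋₊ (B - 1) : ℕ) + 1) := by
    intro x hx
    have h0 : 0 ≤ scale x := mul_nonneg (by linarith [(abs_le.1 hx).1]) (by positivity)
    refine ⟨(Nat.cast_le.2 (min_le_left _ _)).trans (Nat.floor_le h0), ?_⟩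
    obtain h | h := le_total ⌊scale x⌋₊ (B - 1)
    · rw [min_eq_left h]
      exact (Nat.lt_floor_add_one _).le
    · rw [min_eq_right h, Nat.cast_sub hB, Nat.cast_one, sub_add_cancel]
      calc scale x ≤ (2 * R) * (B / (2 * R)) :=
            mul_le_mul_of_nonneg_right (by linarith [(abs_le.1 hx).2]) (by positivity)
        _ = B := mul_div_cancel₀ _ (by positivity)
  refine ⟨fun x => ⟨min ⌊scale x⌋₊ (B - 1), by omega⟩, fun x y hx hy hxy => ?_⟩
  have hx' := hcell x hx
  rw [Fin.mk.inj_iff.1 hxy] at hx'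
  have hscale : |scale x - scale y| ≤ 1 := by
    simpa using abs_sub_le_of_le_of_le hx'.1 hx'.2 (hcell y hy).1 (hcell y hy).2
  have hsub : scale x - scale y = (x - y) * (B / (2 * R)) := by ring
  rwa [hsub, abs_mul, abs_of_pos (by positivity : 0 < B / (2 * R)),
    ← le_div_iff₀ (by positivity), one_div_div] at hscale

lemma exists_ne_close {α κ : Type} [Fintype α] [Fintype κ] (Φ : α → κ → ℝ) {R : ℝ}
    (hΦ : ∀ a k, |Φ a k| ≤ R) {B : ℕ} (hB : 1 ≤ B) (hcard : B ^ Fintype.card κ < Fintype.card α) :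
    ∃ a b, a ≠ b ∧ ∀ k, |Φ a k - Φ b k| ≤ 2 * R / B := by
  classical
  obtain ⟨cell, hcell⟩ := exists_cell hB R
  obtain ⟨a, b, hab, h⟩ :=
    Fintype.exists_ne_map_eq_of_card_lt (fun a k => cell (Φ a k)) (by simpa using hcard)
  exact ⟨a, b, hab, fun k => hcell _ _ (hΦ a k) (hΦ b k) (congrFun h k)⟩

lemma exists_ne_sum_close {ι β κ : Type} [Fintype β] [Fintype κ] (A : Finset ι)
    (w : κ → ι → β → ℝ) {R : ℝ} (hw : ∀ k, ∀ t ∈ A, ∀ b, |w k t b| ≤ R) {B : ℕ} (hB : 1 ≤ B)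
    (hcard : B ^ Fintype.card κ < Fintype.card β ^ A.card) :
    ∃ (c c' : ι → β) (C : Finset ι), C ⊆ A ∧ C.Nonempty ∧ (∀ t ∈ C, c t ≠ c' t) ∧
      ∀ k, |∑ t ∈ C, w k t (c t) - ∑ t ∈ C, w k t (c' t)| ≤ 2 * (A.card * R) / B := by
  classical
  obtain ⟨c, c', hne, hclose⟩ := exists_ne_close
    (fun (c : A → β) k => ∑ t : A, w k t (c t)) (R := A.card * R) (fun c k => by
      refine (Finset.abs_sum_le_sum_abs _ _).trans
        ((Finset.sum_le_card_nsmul _ _ R fun (t : A) _ => hw k t t.2 (c t)).trans_eq ?_)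
      rw [Finset.card_univ, Fintype.card_coe, nsmul_eq_mul]) hB (by simpa using hcard)
  obtain ⟨t₀, ht₀⟩ := Function.ne_iff.1 hne
  let extend : (A → β) → ι → β := fun c t => if ht : t ∈ A then c ⟨t, ht⟩ else c t₀
  refine ⟨extend c, extend c', A.filter fun t => extend c t ≠ extend c' t,
    Finset.filter_subset _ _, ⟨t₀, Finset.mem_filter.2 ⟨t₀.2, by simpa [extend] using ht₀⟩⟩,
    fun t ht => (Finset.mem_filter.1 ht).2, fun k => ?_⟩
  have hsum : ∀ c : A → β, ∑ t : A, w k t (c t) = ∑ t ∈ A, w k t (extend c t) :=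
    fun c => by simp [extend, ← Finset.sum_coe_sort A]
  rw [← Finset.sum_sub_distrib]
  convert hclose k using 2
  rw [hsum, hsum, ← Finset.sum_sub_distrib]
  refine Finset.sum_filter_of_ne fun t _ h heq => h ?_
  rw [heq, sub_self]

end Pigeonhole

/-! ### Attention outputs that cannot be told apart -/

section Confusion

lemma sum_softmax_mul_eq_div {T : ℕ} (β m : ℝ) (ρ v : Fin T → ℝ) :
    ∑ t, softmax β ρ t * v t =
      (∑ t, Real.exp (β * (ρ t - m)) * v t) / ∑ t, Real.exp (β * (ρ t - m)) := by
  have hexp : ∀ t, Real.exp (β * (ρ t - m)) = Real.exp (β * ρ t) * Real.exp (-(β * m)) :=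
    fun t => by rw [← Real.exp_add]; ring_nf
  simp only [softmax, hexp, ← Finset.sum_mul]
  rw [Finset.sum_div]
  refine Finset.sum_congr rfl fun t _ => ?_
  rw [mul_right_comm, mul_div_mul_right _ _ (Real.exp_pos _).ne', div_mul_eq_mul_div]

lemma abs_div_sub_div_le {N N' A A' R η : ℝ} (hA : 1 ≤ A) (hA' : 0 < A') (hN' : |N'| ≤ R * A')
    (hNN' : |N - N'| ≤ η) (hAA' : |A - A'| ≤ η) : |N / A - N' / A'| ≤ η * (1 + R) := by
  have hA0 : 0 < A := zero_lt_one.trans_le hA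
  have hquot : |N' / A'| ≤ R := by rwa [abs_div, abs_of_pos hA', div_le_iff₀ hA']
  have hR : 0 ≤ R := (abs_nonneg _).trans hquot
  have hsub : N / A - N' / A' = ((N - N') - N' / A' * (A - A')) / A := by
    field_simp
    ring
  rw [hsub, abs_div, abs_of_pos hA0]
  calc |N - N' - N' / A' * (A - A')| / A
      ≤ |N - N' - N' / A' * (A - A')| := div_le_self (abs_nonneg _) hA
    _ ≤ |N - N'| + |N' / A' * (A - A')| := abs_sub _ _
    _ ≤ η + R * η := by
        rw [abs_mul]
        gcongr
    _ = η * (1 + R) := by ring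

-- Subtracting the score `m` of the token `u` from all scores makes one summand of the normalizing
-- sum equal to `1`, so that sum may be divided by without loss.
lemma abs_sum_softmax_mul_sub_le {T : ℕ} {β m R η : ℝ} {ρ ρ' v v' : Fin T → ℝ}
    (hv' : ∀ t, |v' t| ≤ R) {u : Fin T} (hu : ρ u = m)
    (hnorm : |∑ t, Real.exp (β * (ρ t - m)) - ∑ t, Real.exp (β * (ρ' t - m))| ≤ η)
    (hsum : |∑ t, Real.exp (β * (ρ t - m)) * v t - ∑ t, Real.exp (β * (ρ' t - m)) * v' t| ≤ η) :
    |∑ t, softmax β ρ t * v t - ∑ t, softmax β ρ' t * v' t| ≤ η * (1 + R) := by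
  rw [sum_softmax_mul_eq_div β m, sum_softmax_mul_eq_div β m]
  refine abs_div_sub_div_le ?_ ?_ ?_ hsum hnorm
  · simpa [hu] using Finset.single_le_sum (f := fun t => Real.exp (β * (ρ t - m)))
      (fun t _ => (Real.exp_pos _).le) (Finset.mem_univ u)
  · exact Finset.sum_pos (fun t _ => Real.exp_pos _) ⟨u, Finset.mem_univ _⟩
  · rw [Finset.mul_sum]
    refine (Finset.abs_sum_le_sum_abs _ _).trans (Finset.sum_le_sum fun t _ => ?_)
    rw [abs_mul, abs_of_pos (Real.exp_pos _), mul_comm]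
    exact mul_le_mul_of_nonneg_right (hv' t) (Real.exp_pos _).le

lemma sum_piecewise_sub_sum_piecewise {ι α : Type} [Fintype ι] [DecidableEq ι] (g : ι → α → ℝ)
    (C : Finset ι) (Y Y' X : ι → α) :
    ∑ t, g t (C.piecewise Y X t) - ∑ t, g t (C.piecewise Y' X t) =
      ∑ t ∈ C, g t (Y t) - ∑ t ∈ C, g t (Y' t) := by
  rw [← Finset.sum_sub_distrib, ← Finset.sum_sub_distrib]
  refine (Finset.sum_subset_zero_on_sdiff C.subset_univ (fun t ht => ?_) fun t ht => ?_).symm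
  · simp only [Finset.piecewise_eq_of_notMem _ _ _ (Finset.mem_sdiff.1 ht).2, sub_self]
  · simp only [Finset.piecewise_eq_of_mem _ _ _ ht]

-- The pigeonhole principle is applied to all the unnormalized attention sums at once, with the
-- index `none` standing for the normalizing sums.
lemma exists_ne_softmax_close {T s n : ℕ} {α β : Type} [Fintype β]
    (sc : Fin s → Fin T → α → ℝ) (val : Fin s → Fin n → Fin T → α → ℝ) {Ω : Set α} {R : ℝ}
    (hR : 1 ≤ R) (hval : ∀ j r t, ∀ x ∈ Ω, |val j r t x| ≤ R) {lam : ℝ} (hlam : 0 ≤ lam)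
    {X₀ : Fin T → α} {y : Fin T → β → α} (hX₀ : ∀ t, X₀ t ∈ Ω) (hy : ∀ t b, y t b ∈ Ω)
    {A W : Finset (Fin T)} (hAW : Disjoint A W)
    (hdom : ∀ j, ∃ u ∈ W, ∀ t ∉ W, ∀ b, sc j t (y t b) ≤ sc j u (X₀ u))
    {B : ℕ} (hB : 1 ≤ B) (hcard : B ^ (s * (n + 1)) < Fintype.card β ^ A.card) :
    ∃ (c c' : Fin T → β) (C : Finset (Fin T)), C ⊆ A ∧ C.Nonempty ∧ (∀ t ∈ C, c t ≠ c' t) ∧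
      let X : (Fin T → β) → Fin T → α := fun c => C.piecewise (fun t => y t (c t)) X₀
      ∀ j r, |∑ t, softmax lam (fun t => sc j t (X c t)) t * val j r t (X c t) -
        ∑ t, softmax lam (fun t => sc j t (X c' t)) t * val j r t (X c' t)| ≤
          2 * (T * R) / B * (1 + R) := by
  choose u huW hu using hdom
  let w : Fin s × Option (Fin n) → Fin T → α → ℝ := fun k t x =>
    Real.exp (lam * (sc k.1 t x - sc k.1 (u k.1) (X₀ (u k.1)))) * k.2.elim 1 (val k.1 · t x)
  have hw : ∀ k, ∀ t ∈ A, ∀ b, |w k t (y t b)| ≤ R := fun ⟨j, o⟩ t ht b => by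
    have hexp : Real.exp (lam * (sc j t (y t b) - sc j (u j) (X₀ (u j)))) ≤ 1 :=
      Real.exp_le_one_iff.2 (mul_nonpos_of_nonneg_of_nonpos hlam
        (sub_nonpos.2 (hu j t (Finset.disjoint_left.1 hAW ht) b)))
    rw [abs_mul, abs_of_pos (Real.exp_pos _)]
    refine (mul_le_of_le_one_left (abs_nonneg _) hexp).trans ?_
    cases o with
    | none => simpa using hR
    | some r => exact hval j r t _ (hy t b)
  obtain ⟨c, c', C, hCA, hC, hne, hclose⟩ :=
    exists_ne_sum_close A (fun k t b => w k t (y t b)) hw hB (by simpa using hcard)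
  have hA : 2 * (A.card * R) / B ≤ 2 * (T * R) / B := by
    gcongr
    exact_mod_cast (Finset.card_le_univ A).trans_eq (Fintype.card_fin T)
  refine ⟨c, c', C, hCA, hC, hne, ?_⟩
  intro X j r
  have hsum : ∀ k, |∑ t, w k t (X c t) - ∑ t, w k t (X c' t)| ≤ 2 * (T * R) / B := fun k =>
    (congrArg abs (sum_piecewise_sub_sum_piecewise (w k) C _ _ X₀)).trans_le ((hclose k).trans hA)
  have hXu : X c (u j) = X₀ (u j) := Finset.piecewise_eq_of_notMem _ _ _
    fun h => Finset.disjoint_left.1 hAW (hCA h) (huW j)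
  have hX : ∀ t, X c' t ∈ Ω := fun t =>
    C.piecewise_cases (fun t => y t (c' t)) X₀ (· ∈ Ω) (hy t _) (hX₀ t)
  exact abs_sum_softmax_mul_sub_le (m := sc j (u j) (X₀ (u j))) (u := u j)
    (fun t => hval j r t _ (hX t)) (congrArg (sc j (u j)) hXu)
    (by simpa [w] using hsum (j, none)) (hsum (j, some r))

variable {d T D s n : ℕ} {F₀ : (Fin D → ℝ) → ℝ} {f : Fin D → (Fin d → ℝ) → ℝ}
  {S : Fin D → Finset (Fin T)} {xmin : Fin D → Fin d → ℝ} {κ ρ : ℝ}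
  {point : Fin D → ℝ → Fin d → ℝ}

lemma IsProbe.exists_confused_inputs (htask : IsRetrievalTask F₀ f S xmin)
    (hp : IsProbe F₀ f xmin κ ρ point) (hT : 1 ≤ T) (hs : 1 ≤ s) (hsD : s < D) {a : ℕ}
    (hS : ∀ i, s + D + a ≤ (S i).card + 1) {Δ : ℝ} (hΔ : 0 ≤ Δ) {q B : ℕ} (hB : 1 ≤ B)
    (hΔq : Δ * (T * q) ≤ ρ) (hcard : B ^ (s * (n + 1)) < q ^ a)
    (sc : Fin s → Fin T → (Fin d → ℝ) → ℝ) (val : Fin s → Fin n → Fin T → (Fin d → ℝ) → ℝ)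
    {R : ℝ} (hR : 1 ≤ R) (hval : ∀ j r t, ∀ x ∈ cube d, |val j r t x| ≤ R)
    {β : ℝ} (hβ : 0 ≤ β) :
    ∃ X ∈ inputSpace d T, ∃ X' ∈ inputSpace d T,
      κ * Δ ≤ |retrievalTarget F₀ f S X - retrievalTarget F₀ f S X'| ∧
      ∀ j r, |∑ t, softmax β (fun t => sc j t (X t)) t * val j r t (X t) -
        ∑ t, softmax β (fun t => sc j t (X' t)) t * val j r t (X' t)| ≤
          2 * (T * R) / B * (1 + R) := by
  obtain ⟨level, hlevel, hsep⟩ := exists_separated (o := Fin T × Fin q) hΔ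
  have hlevel' : ∀ k, level k ∈ Set.Icc 0 ρ := fun k =>
    ⟨(hlevel k).1, (hlevel k).2.trans (by simpa using hΔq)⟩
  have hq : 0 < q := Nat.pos_of_ne_zero fun hq => by
    rw [hq] at hcard
    exact absurd hcard ((zero_pow_le_one a).trans (Nat.one_le_pow _ _ hB)).not_gt
  have : Nonempty (Fin T × Fin q) := ⟨⟨0, hT⟩, ⟨0, hq⟩⟩
  obtain ⟨i₁, W, X₀, hW, hX₀, hdom⟩ :=
    hp.exists_dominating_background (S := S) hT hs hsD (fun i => by have := hS i; omega) sc hlevel'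
  have ha : a ≤ (S i₁ \ W).card := by
    have := hS i₁
    have := Finset.le_card_sdiff W (S i₁)
    omega
  obtain ⟨c, c', C, hCS, hC, hne, hclose⟩ := exists_ne_softmax_close sc val hR hval hβ
    (y := fun t b => point i₁ (level (t, b))) hX₀.mem_inputSpace
    (fun t b => hp.point_mem i₁ _ (hlevel' _)) Finset.sdiff_disjoint
    (fun j => (hdom j).imp fun u hu => ⟨hu.1, fun t ht b => hu.2 t ht (t, b)⟩) hB
    (hcard.trans_le (by simpa using Nat.pow_le_pow_right hq ha))
  let X : (Fin T → Fin q) → Fin T → Fin d → ℝ := fun c =>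
    C.piecewise (fun t => point i₁ (level (t, c t))) X₀
  have hX : ∀ c, X c ∈ inputSpace d T := fun c t =>
    C.piecewise_cases (fun t => point i₁ (level (t, c t))) X₀ (· ∈ cube d)
      (hp.point_mem i₁ _ (hlevel' _)) (hX₀.mem_inputSpace t)
  have htarget := fun c : Fin T → Fin q => hX₀.exists_retrievalTarget_piecewise htask hp hC
    (hCS.trans Finset.sdiff_subset) (Finset.sdiff_disjoint.mono_left hCS)
    fun t => hlevel' (t, c t)
  obtain ⟨t, ht, hF⟩ := htarget c
  obtain ⟨t', -, hF'⟩ := htarget c'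
  refine ⟨X c, hX c, X c', hX c', ?_, hclose⟩
  have hlevels : (t, c t) ≠ (t', c' t') := fun h => hne t ht (by
    obtain ⟨rfl, h⟩ := Prod.mk.inj h
    exact h)
  rw [hF, hF']
  exact (mul_le_mul_of_nonneg_left (hsep _ _ hlevels) hp.rate_pos.le).trans
    (hp.rate_le i₁ _ (hlevel' _) _ (hlevel' _))

end Confusion

/-! ### Lower bound for few heads -/

section LowerBound

lemma abs_mulVec_sub_mulVec_le {ι κ : Type} [Fintype ι] {A : Matrix κ ι ℝ} {r : κ}
    (hA : ∀ j, |A r j| ≤ 1) {y y' : ι → ℝ} {c : ℝ} (hy : ∀ j, |y j - y' j| ≤ c) :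
    |(A *ᵥ y) r - (A *ᵥ y') r| ≤ (Finset.univ.filter fun j => A r j ≠ 0).card * c := by
  rw [← Pi.sub_apply, ← Matrix.mulVec_sub, Finset.card_filter, Nat.cast_sum, Finset.sum_mul]
  refine (Finset.abs_sum_le_sum_abs _ _).trans (Finset.sum_le_sum fun j _ => ?_)
  rw [abs_mul]
  split_ifs with h
  · rw [Nat.cast_one, one_mul]
    exact (mul_le_of_le_one_left (abs_nonneg _) (hA j)).trans (hy j)
  · simp [not_not.1 h]

lemma abs_mulVec_sub_mulVec_le_card {m p : ℕ} {A : Matrix (Fin p) (Fin m) ℝ} {r : Fin p}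
    (hA : ∀ j, |A r j| ≤ 1) {y y' : Fin m → ℝ} {c : ℝ} (hc : 0 ≤ c) (hy : ∀ j, |y j - y' j| ≤ c) :
    |(A *ᵥ y) r - (A *ᵥ y') r| ≤ m * c :=
  (abs_mulVec_sub_mulVec_le hA hy).trans (mul_le_mul_of_nonneg_right
    (Nat.cast_le.2 ((Finset.card_le_univ _).trans_eq (Fintype.card_fin m))) hc)

lemma sum_card_ne_zero_le_nonzeroCount {p m : ℕ} (A : Matrix (Fin p) (Fin m) ℝ) (b : Fin p → ℝ) :
    ∑ r, (Finset.univ.filter fun j => A r j ≠ 0).card ≤ nonzeroCount A b := by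
  refine le_add_right (le_of_eq ?_)
  rw [Set.ncard_eq_toFinset_card', Set.toFinset_ofPred, Finset.card_filter, Fintype.sum_prod_type]
  exact Finset.sum_congr rfl fun r _ => Finset.card_filter _ _

lemma FFN.abs_eval_sub_le {m : ℕ} {τ : ℝ → ℝ} (hτ : LipschitzWith 1 τ) (G : FFN 1 2 m)
    (hG : G.WeightsIn unitWeights) {y y' : Fin m → ℝ} {c : ℝ} (hc : 0 ≤ c)
    (hy : ∀ j, |y j - y' j| ≤ c) :
    |G.eval τ y 0 - G.eval τ y' 0| ≤ G.paramCount * c := by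
  match G, hG with
  | .layer (p := p) A b (.output A' b'), ⟨⟨hA, _⟩, hA', _⟩ =>
    let hidden : (Fin m → ℝ) → Fin p → ℝ := fun y r => τ ((A *ᵥ y + b) r)
    have hhidden : ∀ r, |hidden y r - hidden y' r| ≤
        (Finset.univ.filter fun j => A r j ≠ 0).card * c := fun r => by
      refine (abs_sub_le_of_lipschitzWith hτ _ _).trans ?_
      rw [Pi.add_apply, Pi.add_apply, add_sub_add_right_eq_sub]
      exact abs_mulVec_sub_mulVec_le (fun j => abs_le_one_of_mem_unitWeights (hA r j)) hy
    calc |(A' *ᵥ hidden y + b') 0 - (A' *ᵥ hidden y' + b') 0|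
        = |∑ r, A' 0 r * (hidden y r - hidden y' r)| := by
          simp only [Pi.add_apply, add_sub_add_right_eq_sub, Matrix.mulVec, dotProduct, mul_sub,
            Finset.sum_sub_distrib]
      _ ≤ ∑ r, |A' 0 r * (hidden y r - hidden y' r)| := Finset.abs_sum_le_sum_abs _ _
      _ ≤ ∑ r, (Finset.univ.filter fun j => A r j ≠ 0).card * c := by
          refine Finset.sum_le_sum fun r _ => ?_
          rw [abs_mul]
          exact (mul_le_of_le_one_left (abs_nonneg _)
            (abs_le_one_of_mem_unitWeights (hA' 0 r))).trans (hhidden r)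
      _ ≤ (nonzeroCount A b + nonzeroCount A' b' : ℕ) * c := by
          rw [← Finset.sum_mul, ← Nat.cast_sum]
          exact mul_le_mul_of_nonneg_right (Nat.cast_le.2
            (le_add_right (sum_card_ne_zero_le_nonzeroCount A b))) hc

lemma abs_le_one_of_sqrt_sum_sq_le_one {ι : Type} [Fintype ι] {e : ι → ℝ}
    (he : √(∑ q, e q ^ 2) ≤ 1) (q : ι) : |e q| ≤ 1 := by
  rw [Real.sqrt_le_one] at he
  exact (sq_le_one_iff_abs_le_one _).1
    ((Finset.single_le_sum (fun q _ => sq_nonneg (e q)) (Finset.mem_univ q)).trans he)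

lemma Attention.abs_out_sub_le {h n T : ℕ} {a : Attention h n} (ha : a.Admissible)
    {e e' : Fin T → Fin (h * n) → ℝ} {c : ℝ} (hc : 0 ≤ c)
    (hhead : ∀ i r, |a.head e i r - a.head e' i r| ≤ c) (q : Fin (h * n)) :
    |a.out e q - a.out e' q| ≤ (h * n : ℕ) * c := by
  obtain ⟨-, -, -, -, hWO⟩ := ha
  rw [Attention.out, Attention.out, Pi.add_apply, Pi.add_apply, add_sub_add_left_eq_sub]
  exact abs_mulVec_sub_mulVec_le_card (hWO q) hc fun q' => hhead _ _

variable {d T D s n : ℕ} {F₀ : (Fin D → ℝ) → ℝ} {f : Fin D → (Fin d → ℝ) → ℝ}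
  {S : Fin D → Finset (Fin T)} {xmin : Fin D → Fin d → ℝ} {κ ρ : ℝ}
  {point : Fin D → ℝ → Fin d → ℝ}

lemma IsProbe.rate_mul_le_of_approx (htask : IsRetrievalTask F₀ f S xmin)
    (hp : IsProbe F₀ f xmin κ ρ point) (hT : 1 ≤ T) (hs : 1 ≤ s) (hn : 1 ≤ n) (hsD : s < D) {a : ℕ}
    (hS : ∀ i, s + D + a ≤ (S i).card + 1) {Δ : ℝ} (hΔ : 0 ≤ Δ) {q B : ℕ} (hB : 1 ≤ B)
    (hΔq : Δ * (T * q) ≤ ρ) (hcard : B ^ (s * (n + 1)) < q ^ a) {ℓ M : ℕ}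
    {H : (Fin T → Fin d → ℝ) → ℝ} (hH : H ∈ hypothesisClass lipschitzActivations ℓ 2 s n d T M)
    {η : ℝ} (hHF : ∀ X ∈ inputSpace d T, |H X - retrievalTarget F₀ f S X| ≤ η) :
    κ * Δ ≤ 2 * η +
      M * ((s * n : ℕ) * (2 * (T * (s * n : ℕ)) / B * (1 + (s * n : ℕ)))) := by
  obtain ⟨σ, -, τ, hτ, P, α, G, hP, hα, hG, hM, rfl⟩ := hH
  have hencode : ∀ x ∈ cube d, ∀ t q, |encode σ P x t q| ≤ 1 :=
    fun x hx t => abs_le_one_of_sqrt_sum_sq_le_one (hP x hx t)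
  have hvalue : ∀ j r (t : Fin T), ∀ x ∈ cube d,
      |(α.WV j *ᵥ encode σ P x t) r| ≤ (s * n : ℕ) := fun j r t x hx => by
    simpa using abs_mulVec_sub_mulVec_le_card (hα.2.2.2.1 j r) zero_le_one (y' := 0)
      fun q => by simpa using hencode x hx t q
  set E : ℝ := ((s * n : ℕ) : ℝ)
  have hE : 1 ≤ E := Nat.one_le_cast.2 (Nat.mul_pos hs hn)
  obtain ⟨X, hX, X', hX', hsep, hclose⟩ := hp.exists_confused_inputs htask hT hs hsD hS hΔ hB hΔq
    hcard (fun j t x => (α.WQ j *ᵥ α.c₀) ⬝ᵥ (α.WK j *ᵥ encode σ P x t))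
    (fun j r t x => (α.WV j *ᵥ encode σ P x t) r) hE hvalue hα.1.le
  let H : (Fin T → Fin d → ℝ) → ℝ := fun X => G.eval τ (α.out fun t => encode σ P (X t) t) 0
  have hH : |H X - H X'| ≤ M * (E * (2 * (T * E) / B * (1 + E))) := by
    have hGM : (G.paramCount : ℝ) ≤ M := Nat.cast_le.2 ((Nat.le_add_left _ _).trans hM)
    refine (G.abs_eval_sub_le hτ hG (by positivity) (α.abs_out_sub_le hα (by positivity)
      fun j r => ?_)).trans (mul_le_mul_of_nonneg_right hGM (by positivity))
    simpa [Attention.head] using hclose j r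
  calc κ * Δ ≤ |retrievalTarget F₀ f S X - retrievalTarget F₀ f S X'| := hsep
    _ ≤ |H X - H X'| + |H X - retrievalTarget F₀ f S X| + |H X' - retrievalTarget F₀ f S X'| := by
        grind
    _ ≤ _ := by linarith [hHF X hX, hHF X' hX']

lemma exists_pow_lt_pow {x e : ℝ} (hx : 2 ≤ x) (he : 0 < e) {N a : ℕ} (h : e * N < a) :
    ∃ q B : ℕ, 1 ≤ B ∧ (q : ℝ) ≤ 2 * x ∧ B ^ N < q ^ a ∧ x ^ e ≤ 2 * B := by
  have hxq : x ≤ ⌊2 * x⌋₊ := by linarith [Nat.lt_floor_add_one (2 * x)]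
  set q : ℕ := ⌊2 * x⌋₊
  have hq : (1 : ℝ) < q := by linarith
  have hqe : 1 ≤ (q : ℝ) ^ e := Real.one_le_rpow hq.le he.le
  have hB : 1 ≤ ⌊(q : ℝ) ^ e⌋₊ := Nat.le_floor (by simpa using hqe)
  refine ⟨q, ⌊(q : ℝ) ^ e⌋₊, hB, Nat.floor_le (by linarith), ?_, ?_⟩
  · rw [← Nat.cast_lt (α := ℝ), Nat.cast_pow, Nat.cast_pow]
    calc (⌊(q : ℝ) ^ e⌋₊ : ℝ) ^ N ≤ ((q : ℝ) ^ e) ^ N := by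
          gcongr
          exact Nat.floor_le (by positivity)
      _ = (q : ℝ) ^ (e * N) := by rw [Real.rpow_mul (by positivity), Real.rpow_natCast]
      _ < (q : ℝ) ^ (a : ℝ) := Real.rpow_lt_rpow_of_exponent_lt hq h
      _ = (q : ℝ) ^ a := Real.rpow_natCast _ _
  · calc x ^ e ≤ (q : ℝ) ^ e := Real.rpow_le_rpow (by linarith) hxq he.le
      _ ≤ ⌊(q : ℝ) ^ e⌋₊ + 1 := (Nat.lt_floor_add_one _).le
      _ ≤ 2 * ⌊(q : ℝ) ^ e⌋₊ := by
          have : (1 : ℝ) ≤ ⌊(q : ℝ) ^ e⌋₊ := Nat.one_le_cast.2 hB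
          linarith

lemma IsRetrievalTask.add_ceil_le_card (htask : IsRetrievalTask F₀ f S xmin) {m : ℝ}
    (hm : m = (T : ℝ) / 4 - s - D + 1) (hm0 : 0 < m) (i : Fin D) :
    s + D + ⌈m⌉₊ ≤ (S i).card + 1 := by
  have hcard := htask.quarter_le_card i
  have hle : s + D ≤ (S i).card + 1 := by
    rw [← Nat.cast_le (α := ℝ)]
    push_cast
    linarith
  have hceil : ⌈m⌉₊ ≤ (S i).card + 1 - (s + D) := Nat.ceil_le.2 (by push_cast [hle]; linarith)
  omega

lemma IsRetrievalTask.few_heads_lower_bound (htask : IsRetrievalTask F₀ f S xmin) (hT : 1 ≤ T)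
    (hs : 1 ≤ s) (hn : 1 ≤ n) (hsD : s < D) {m e : ℝ} (hm : m = (T : ℝ) / 4 - s - D + 1)
    (he : e = m / (((n : ℝ) + 1) * s + 1)) (hm0 : 0 < m) :
    ∃ c : ℝ, 0 < c ∧ ∃ ε₀ : ℝ, 0 < ε₀ ∧ ∀ ε : ℝ, 0 < ε → ε < ε₀ → ∀ ℓ M : ℕ,
      EpsApproximates (hypothesisClass lipschitzActivations ℓ 2 s n d T M) ε
        {retrievalTarget F₀ f S} → c * (1 / ε) ^ (e - 1) ≤ M := by
  obtain ⟨κ, ρ, point, hp⟩ := htask.exists_isProbe (by omega)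
  have hκ := hp.rate_pos
  have hρ := hp.height_pos
  have : (0 : ℝ) < T := Nat.cast_pos.2 hT
  have hw : (0 : ℝ) < ((n : ℝ) + 1) * s + 1 := by positivity
  have he0 : 0 < e := he ▸ div_pos hm0 hw
  have hexp : e * (s * (n + 1) : ℕ) < ⌈m⌉₊ := by
    refine lt_of_lt_of_le ?_ (Nat.le_ceil m)
    rw [he, div_mul_eq_mul_div, div_lt_iff₀ hw]
    push_cast
    nlinarith
  set E : ℝ := ((s * n : ℕ) : ℝ) with hE
  have : 0 < E := Nat.cast_pos.2 (Nat.mul_pos hs hn)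
  set K : ℝ := ρ * κ / (8 * T) with hK
  have hK0 : 0 < K := by positivity
  set Z : ℝ := E * (2 * (T * E) * (1 + E))
  have hZ0 : 0 < Z := by positivity
  refine ⟨K ^ e / Z, by positivity, K / 2, by positivity, fun ε hε hεK ℓ M happ => ?_⟩
  obtain ⟨H, hH, η, hη, hHF⟩ := happ _ rfl
  obtain ⟨q, B, hB, hq, hcard, hxB⟩ :=
    exists_pow_lt_pow (x := K / ε) (by rw [le_div_iff₀ hε]; linarith) he0 hexp
  have hB0 : (0 : ℝ) < B := Nat.cast_pos.2 hB
  have hΔq : 4 * ε / κ * (T * q) ≤ ρ := by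
    calc 4 * ε / κ * (T * q) ≤ 4 * ε / κ * (T * (2 * (K / ε))) := by gcongr
      _ = ρ := by rw [hK]; field_simp; norm_num
  have hmain : 2 * ε * B ≤ M * Z := by
    have hMB := hp.rate_mul_le_of_approx htask hT hs hn hsD
      (htask.add_ceil_le_card hm hm0) (by positivity) hB hΔq hcard hH hHF
    have hZB : E * (2 * (T * E) / B * (1 + E)) = Z / B := by ring
    rw [mul_div_cancel₀ _ hκ.ne', ← hE, hZB] at hMB
    rw [← le_div_iff₀ hB0, mul_div_assoc]
    linarith
  rw [Real.rpow_sub_one (by positivity), one_div ε, div_inv_eq_mul, div_mul_eq_mul_div,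
    div_le_iff₀ hZ0]
  calc K ^ e * (ε⁻¹ ^ e * ε) = (K / ε) ^ e * ε := by
        rw [← mul_assoc, ← Real.mul_rpow hK0.le (by positivity), div_eq_mul_inv]
    _ ≤ 2 * B * ε := by gcongr
    _ = 2 * ε * B := by ring
    _ ≤ M * Z := hmain

theorem few_heads_lower_bound (hT : 1 ≤ T) (hs : 1 ≤ s) (hn : 1 ≤ n) (hsD : s < D)
    {𝓕 : Set ((Fin T → Fin d → ℝ) → ℝ)} (h𝓕 : 𝓕 ⊆ targetClass d T D) (hne : 𝓕.Nonempty) :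
    ∃ c : ℝ, 0 < c ∧ ∃ ε₀ : ℝ, 0 < ε₀ ∧ ∀ ε : ℝ, 0 < ε → ε < ε₀ → ∀ ℓ M : ℕ, 1 ≤ M →
      EpsApproximates (hypothesisClass lipschitzActivations ℓ 2 s n d T M) ε 𝓕 →
      c * (1 / ε) ^ (((T : ℝ) / 4 - s - D + 1) / (((n : ℝ) + 1) * s + 1) - 1) ≤ M := by
  obtain hm | hm := le_or_gt ((T : ℝ) / 4 - s - D + 1) 0
  · refine ⟨1, one_pos, 1, one_pos, fun ε hε hε1 ℓ M hM _ => ?_⟩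
    rw [one_mul]
    refine (Real.rpow_le_one_of_one_le_of_nonpos ((one_le_div hε).2 hε1.le) ?_).trans
      (Nat.one_le_cast.2 hM)
    linarith [div_nonpos_of_nonpos_of_nonneg hm (by positivity : 0 ≤ ((n : ℝ) + 1) * s + 1)]
  obtain ⟨F, hF⟩ := hne
  obtain ⟨F₀, f, S, xmin, htask, rfl⟩ := h𝓕 hF
  obtain ⟨c, hc, ε₀, hε₀, hbound⟩ := htask.few_heads_lower_bound hT hs hn hsD rfl rfl hm
  exact ⟨c, hc, ε₀, hε₀, fun ε hε hεε₀ ℓ M _ happ =>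
    hbound ε hε hεε₀ ℓ M fun F' hF' => happ F' (hF' ▸ hF)⟩

end LowerBound

end TransformerRates

end

theorem theorem2 (d T D : ℕ) (hd : 1 ≤ d) (hT : 1 ≤ T) (hD : 1 ≤ D) :
    -- (1) `D` heads of dimension `2`
    (∀ (C₁ γ₁ C₂ γ₂ : ℝ) (Λ : NNReal), 0 < C₁ → 0 < γ₁ → 0 < C₂ → 0 < γ₂ →
      ∃ C : ℝ, 0 < C ∧ ∀ ε : ℝ, 0 < ε → ∀ M : ℕ, C / ε ^ max γ₁ γ₂ < M →
        TransformerRates.EpsApproximates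
          (TransformerRates.hypothesisClass TransformerRates.lipschitzActivations 2 2 D 2 d T M) ε
          (TransformerRates.approxTargetClass TransformerRates.lipschitzActivations Set.univ
            d T D C₁ γ₁ C₂ γ₂ Λ)) ∧
    -- (2) fewer than `D` heads
    (∀ s n : ℕ, 1 ≤ s → 1 ≤ n → s < D →
      ∀ 𝓕 : Set ((Fin T → Fin d → ℝ) → ℝ), 𝓕 ⊆ TransformerRates.targetClass d T D → 𝓕.Nonempty →
      ∃ c : ℝ, 0 < c ∧ ∃ ε₀ : ℝ, 0 < ε₀ ∧ ∀ ε : ℝ, 0 < ε → ε < ε₀ → ∀ ℓ M : ℕ, 1 ≤ M →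
        TransformerRates.EpsApproximates
          (TransformerRates.hypothesisClass TransformerRates.lipschitzActivations ℓ 2 s n d T M) ε
          𝓕 →
        c * (1 / ε) ^ (((T : ℝ) / 4 - s - D + 1) / (((n : ℝ) + 1) * s + 1) - 1) ≤ M) ∧
    -- (3) one head of large dimension and a five-layer ReLU feed-forward block
    (∀ (C₁ γ₁ C₂ γ₂ : ℝ) (Λ : NNReal), 0 < C₁ → 0 < γ₁ → 0 < C₂ → 0 < γ₂ →
      ∃ C : ℝ, 0 < C ∧ ∀ n : ℕ, T * d ≤ n → ∀ ε : ℝ, 0 < ε → ∀ M : ℕ,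
        C / ε ^ (1 + max γ₁ γ₂) < M →
        TransformerRates.EpsApproximates
          (TransformerRates.hypothesisClass {TransformerRates.relu} 2 5 1 n d T M) ε
          (TransformerRates.approxTargetClass {TransformerRates.relu} TransformerRates.unitWeights
            d T D C₁ γ₁ C₂ γ₂ Λ)) := by
  refine ⟨fun C₁ γ₁ C₂ γ₂ Λ hC₁ hγ₁ hC₂ _ => ?_, fun s n hs hn hsD 𝓕 h𝓕 hne => ?_,
    fun C₁ γ₁ C₂ γ₂ Λ hC₁ hγ₁ hC₂ _ => ?_⟩
  · exact TransformerRates.multihead_upper_bound hT hD γ₂ Λ hC₁ hγ₁ hC₂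
  · exact TransformerRates.few_heads_lower_bound hT hs hn hsD h𝓕 hne
  · exact TransformerRates.singleHead_upper_bound hd hT γ₂ Λ hC₁ hγ₁ hC₂
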